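/- Let $\mathbb H$ be the quaternions and $V$ a bilateral (two-sided) quaternionic Banach space (i.e. $(av)b=a(vb)$, $rv=vr$ for real $r$, and the norm satisfies $\|av\|=|a|\|v\|$, $\|va\|=\|v\||a|$ for $a,b\in\mathbb H$, $v\in V$). Let $\mathcal B(V)$ be the space of bounded right linear operators on $V$, with the operator norm and with $(aT)(v)=aT(v)$, $(Ta)(v)=T(av)$. For $T\in\mathcal B(V)$ let $$\sigma_S(T)=\{s\in\mathbb H : T^2-2\,\mathrm{Re}[s]\,T+|s|^2\mathcal I \text{ is not invertible in } \mathcal B(V)\},$$ $$S^{-1}(s,T)=-(T^2-2\,\mathrm{Re}[s]\,T+|s|^2\mathcal I)^{-1}(T-\overline s\,\mathcal I)\qquad (s\notin\sigma_S(T)).$$ A real differentiable function $f$ on an open set $\Omega\subseteq\mathbb H$ is (left) regular if $\frac12\left(\frac{\partial}{\partial x}+I\frac{\partial}{\partial y}\right)f(x+Iy)=0$ on $\Omega\cap(\mathbb R+I\mathbb R)$ for every imaginary unit $I$. Let $\mathcal R_{\sigma_S(T)}$ be the set of functions $f:\mathbb H\to\mathbb H$ that are regular on some ball $B(0,R)\supseteq\sigma_S(T)$.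 For $f\in\mathcal R_{\sigma_S(T)}$ put $$f(T)=\frac1{2\pi}\int_{\partial U}S^{-1}(s,T)\,ds_I\,f(s),\qquad ds_I=-I\,ds,$$ where $I$ is an imaginary unit and $U$ is a bounded open subset of $L_I=\mathbb R+I\mathbb R$ that contains $L_I\cap\sigma_S(T)$, whose closure lies in a ball $B(0,R)\supseteq\sigma_S(T)$ on which $f$ is regular, and whose positively oriented boundary consists of finitely many closed piecewise $C^1$ curves. Then such $I$ and $U$ exist for every $f\in\mathcal R_{\sigma_S(T)}$, and $f(T)$ does not depend on their choice. If $f,g\in\mathcal R_{\sigma_S(T)}$ and $\lambda\in\mathbb H$, then $f+g,\ f\lambda\in\mathcal R_{\sigma_S(T)}$ and $$(f+g)(T)=f(T)+g(T),\qquad (f\lambda)(T)=f(T)\lambda .$$ Moreover, if $\phi,\psi\in\mathcal R_{\sigma_S(T)}$ are given by power series $\phi(s)=\sum_{n\ge0}s^na_n$, $\psi(s)=\sum_{n\ge0}s^nb_n$ with $a_n,b_n\in\mathbb R$, each converging on a ball centered at $0$ that contains $\sigma_S(T)$, then $\phi\psi\in\mathcal R_{\sigma_S(T)}$ and $$(\phi\psi)(T)=\phi(T)\psi(T).$$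 -/

import Mathlib

open scoped Quaternion

noncomputable section

namespace QuaternionicCalculus

/-! ## Slices of the quaternions and slice regular functions -/

/-- The sphere of purely imaginary unit quaternions. -/
def imagSphere : Set ℍ[ℝ] := {I | I.re = 0 ∧ ‖I‖ = 1}

/-- The parametrization `x + iy ↦ x + Iy` of the plane `L_I = ℝ + Iℝ` by `ℂ`. -/
def slice (I : ℍ[ℝ]) (z : ℂ) : ℍ[ℝ] := (z.re : ℍ[ℝ]) + I * (z.im : ℍ[ℝ])

/-- `f` is left (slice) regular on the open set `Ω`: it is real differentiable there and
`½ (∂/∂x + I ∂/∂y) f(x + Iy) = 0` on `Ω ∩ L_I` for every imaginary unit `I`. -/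
def LeftRegularOn (f : ℍ[ℝ] → ℍ[ℝ]) (Ω : Set ℍ[ℝ]) : Prop :=
  DifferentiableOn ℝ f Ω ∧
    ∀ I ∈ imagSphere, ∀ x y : ℝ, (x : ℍ[ℝ]) + I * (y : ℍ[ℝ]) ∈ Ω →
      (1 / 2 : ℝ) • (deriv (fun u : ℝ => f ((u : ℍ[ℝ]) + I * (y : ℍ[ℝ]))) x
        + I * deriv (fun v : ℝ => f ((x : ℍ[ℝ]) + I * (v : ℍ[ℝ]))) y) = 0

/-! ## Bounded open subsets of a slice and their oriented boundary -/

/-- A closed piecewise continuously differentiable curve, parametrized by `[0, 1]`. -/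
def IsClosedPiecewiseC1 (γ : ℝ → ℂ) : Prop :=
  γ 0 = γ 1 ∧ ∃ (m : ℕ) (t : Fin (m + 1) → ℝ), Monotone t ∧ t 0 = 0 ∧ t (Fin.last m) = 1 ∧
    ∀ i : Fin m, ContDiffOn ℝ 1 γ (Set.Icc (t i.castSucc) (t i.succ))

/-- The winding number of the closed curve `γ` around a point `w` that is not on it. -/
def windingNumber (γ : ℝ → ℂ) (w : ℂ) : ℂ :=
  (2 * Real.pi * Complex.I)⁻¹ * ∫ t in (0 : ℝ)..1, deriv γ t / (γ t - w)

/-- A bounded open set `U` of a plane `L_I` (in the coordinates `x + iy ↔ x + Iy`), whose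
boundary consists of finitely many closed piecewise `C¹` curves, oriented positively with respect
to `U`: together they wind once around every point of `U` and do not wind around the points
outside the closure of `U`. -/
structure SliceDomain where
  /-- the imaginary unit of the plane -/
  I : ℍ[ℝ]
  I_mem : I ∈ imagSphere
  /-- the open set -/
  U : Set ℂ
  isOpen : IsOpen U
  isBounded : Bornology.IsBounded U
  /-- the number of boundary curves -/
  n : ℕ
  /-- the boundary curves -/
  γ : Fin n → ℝ → ℂ
  closed_curve : ∀ k, IsClosedPiecewiseC1 (γ k)
  image_eq : ⋃ k, γ k '' Set.Icc (0 : ℝ) 1 = frontier U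
  winding_inside : ∀ w ∈ U, ∑ k, windingNumber (γ k) w = 1
  winding_outside : ∀ w ∉ closure U, ∑ k, windingNumber (γ k) w = 0

/-! ## Bounded right linear operators on a bilateral quaternionic Banach space

The left action of `ℍ` on `V` is the action of `ℍ[ℝ]`, the right action `v q` is the action
`MulOpposite.op q • v` of the opposite ring. -/

section Operators

variable (V : Type*) [NormedAddCommGroup V] [NormedSpace ℝ V]
  [Module ℍ[ℝ] V] [IsBoundedSMul ℍ[ℝ] V] [IsScalarTower ℝ ℍ[ℝ] V]
  [Module ℍ[ℝ]ᵐᵒᵖ V] [IsBoundedSMul ℍ[ℝ]ᵐᵒᵖ V] [IsScalarTower ℝ ℍ[ℝ]ᵐᵒᵖ V]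
  [SMulCommClass ℍ[ℝ] ℍ[ℝ]ᵐᵒᵖ V]

/-- `𝓑(V)`: the bounded right linear operators on `V`, a real algebra under composition, with the
operator norm. -/
def BoundedOp : Subalgebra ℝ (V →L[ℝ] V) where
  carrier := {T | ∀ (q : ℍ[ℝ]) (v : V), T (MulOpposite.op q • v) = MulOpposite.op q • T v}
  mul_mem' := by
    intro S T hS hT q v
    simp [hS q, hT q]
  add_mem' := by
    intro S T hS hT q v
    simp [hS q, hT q]
  algebraMap_mem' := by
    intro r q v
    have h := (IsScalarTower.to_smulCommClass (R := ℝ) (A := ℍ[ℝ]ᵐᵒᵖ) (M := V)).smul_comm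
      r (MulOpposite.op q) v
    simpa [Algebra.algebraMap_eq_smul_one] using h

/-- `𝓑(V)` is a Banach space. -/
instance [CompleteSpace V] : CompleteSpace (BoundedOp V) := by
  have hc : IsClosed ((BoundedOp V : Set (V →L[ℝ] V))) := by
    have : (BoundedOp V : Set (V →L[ℝ] V)) = ⋂ (q : ℍ[ℝ]) (v : V),
        {T | T (MulOpposite.op q • v) = MulOpposite.op q • T v} := by
      ext T
      simp [BoundedOp]
    rw [this]
    refine isClosed_iInter fun q => isClosed_iInter fun v => ?_
    exact isClosed_eq (ContinuousLinearMap.apply ℝ V (MulOpposite.op q • v)).continuous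
      ((ContinuousLinearMap.apply ℝ V v).continuous.const_smul _)
  exact hc.completeSpace_coe

variable {V}

/-- The operator `a𝓘 : v ↦ a v`. The products of the bilateral space `𝓑(V)` are
`a T = leftMul a * T` and `T a = T * leftMul a`, so that `(a T)(v) = a (T v)` and
`(T a)(v) = T (a v)`. -/
def leftMul (a : ℍ[ℝ]) : BoundedOp V :=
  ⟨{ toFun := fun v => a • v
     map_add' := smul_add a
     map_smul' := fun r v =>
      ((IsScalarTower.to_smulCommClass (R := ℝ) (A := ℍ[ℝ]) (M := V)).smul_comm r a v).symm
     cont := continuous_const_smul a },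
    fun q v => smul_comm a (MulOpposite.op q) v⟩

/-- `T² - 2 Re[s] T + |s|² 𝓘`. -/
def sPolynomial (s : ℍ[ℝ]) (T : BoundedOp V) : BoundedOp V :=
  T ^ 2 - (2 * s.re) • T + (‖s‖ ^ 2) • (1 : BoundedOp V)

/-- The `S`-spectrum. -/
def sSpectrum (T : BoundedOp V) : Set ℍ[ℝ] := {s | ¬ IsUnit (sPolynomial s T)}

/-- The `S`-resolvent operator `-(T² - 2 Re[s] T + |s|² 𝓘)⁻¹ (T - s̄ 𝓘)`, for `s` outside the
`S`-spectrum. -/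
def sResolvent (s : ℍ[ℝ]) (T : BoundedOp V) : BoundedOp V :=
  -(Ring.inverse (sPolynomial s T) * (T - leftMul (star s)))

/-- The functions that are locally regular on `σ_S(T)`: regular on some ball `B(0, R)` that
contains `σ_S(T)`. -/
def locallyRegular (T : BoundedOp V) : Set (ℍ[ℝ] → ℍ[ℝ]) :=
  {f | ∃ R : ℝ, 0 < R ∧ sSpectrum T ⊆ Metric.ball 0 R ∧ LeftRegularOn f (Metric.ball 0 R)}

/-- `D = (I, U)` can be used to compute `f(T)`: `U` contains `L_I ∩ σ_S(T)`, and its closure lies in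
a ball around the origin that contains `σ_S(T)` and on which `f` is regular. -/
def SliceDomain.Admissible (D : SliceDomain) (T : BoundedOp V) (f : ℍ[ℝ] → ℍ[ℝ]) : Prop :=
  (∀ z : ℂ, slice D.I z ∈ sSpectrum T → z ∈ D.U) ∧
    ∃ R : ℝ, 0 < R ∧ sSpectrum T ⊆ Metric.ball 0 R ∧ LeftRegularOn f (Metric.ball 0 R) ∧
      ∀ z ∈ closure D.U, slice D.I z ∈ Metric.ball (0 : ℍ[ℝ]) R

/-- `(1 / 2π) ∫_{∂U} S⁻¹(s, T) ds_I f(s)` with `ds_I = -I ds`. -/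
def SliceDomain.cauchyIntegral (D : SliceDomain) (T : BoundedOp V) (f : ℍ[ℝ] → ℍ[ℝ]) :
    BoundedOp V :=
  (1 / (2 * Real.pi)) • ∑ k, ∫ t in (0 : ℝ)..1,
    sResolvent (slice D.I (D.γ k t)) T * leftMul (-D.I * slice D.I (deriv (D.γ k) t)) *
      leftMul (f (slice D.I (D.γ k t)))

open Classical in
/-- `f(T)`, computed with any choice of `I` and `U`. -/
def funCalc (T : BoundedOp V) (f : ℍ[ℝ] → ℍ[ℝ]) : BoundedOp V :=
  if h : ∃ D : SliceDomain, D.Admissible T f then h.choose.cauchyIntegral T f else 0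

/-- `φ(s) = ∑ sⁿ aₙ` with real coefficients `aₙ`, on a ball `B(0, R)` that contains `σ_S(T)`. -/
def IsRealPowerSeriesNear (T : BoundedOp V) (φ : ℍ[ℝ] → ℍ[ℝ]) : Prop :=
  ∃ (a : ℕ → ℝ) (R : ℝ), 0 < R ∧ sSpectrum T ⊆ Metric.ball 0 R ∧
    ∀ s ∈ Metric.ball (0 : ℍ[ℝ]) R, HasSum (fun n : ℕ => s ^ n * (a n : ℍ[ℝ])) (φ s)

end Operators

end QuaternionicCalculus

end

open QuaternionicCalculus

/-!
An imaginary unit `I` makes `𝓑(V)` a complex Banach space, `x + iy` acting as right multiplication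
by `(x + Iy) 𝓘`. Left multiplication by `T` is complex linear on it, and
`T² - 2 Re[z] T + |z|² = (z - T)(z̄ - T)`, so `S⁻¹(z, T)` is the resolvent of this complex linear
operator, applied to `𝓘`. A Liouville argument then gives `(1/2π) ∮ S⁻¹(s, T) ds_I sᵐ = Tᵐ` for
every admissible boundary. A function that is regular on a ball is a power series `∑ sⁿ aₙ` there;
integrating it termwise yields `f(T) = ∑ Tⁿ aₙ`, which involves neither `I` nor `U`. Sums and right
multiples are immediate, and products follow from the Cauchy product, because real coefficients of
`φ` commute with `T` and with the slices.
-/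

noncomputable section

namespace QuaternionicCalculus

open Set Filter Topology MeasureTheory

/-! ### Closed piecewise `C¹` curves -/

theorem exists_mem_Ioc_castSucc_succ {α : Type*} [LinearOrder α] {m : ℕ} (t : Fin (m + 1) → α)
    (j : Fin (m + 1)) {x : α} (h0 : t 0 < x) (hj : x ≤ t j) :
    ∃ i : Fin m, x ∈ Ioc (t i.castSucc) (t i.succ) := by
  induction j using Fin.induction with
  | zero => exact absurd hj h0.not_ge
  | succ i ih =>
    rcases le_or_gt x (t i.castSucc) with h | h
    · exact ih h
    · exact ⟨i, h, hj⟩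

theorem exists_bound_deriv_of_contDiffOn_Icc {F : Type*} [NormedAddCommGroup F] [NormedSpace ℝ F]
    {f : ℝ → F} {a b : ℝ} (hf : ContDiffOn ℝ 1 f (Icc a b)) :
    ∃ C, ∀ x ∈ Ioo a b, DifferentiableAt ℝ f x ∧ ‖deriv f x‖ ≤ C := by
  rcases lt_or_ge a b with hab | hab
  · obtain ⟨C, hC⟩ := isCompact_Icc.exists_bound_of_continuousOn
      (hf.continuousOn_derivWithin (uniqueDiffOn_Icc hab) le_rfl)
    refine ⟨C, fun x hx => ?_⟩
    have hx' : Icc a b ∈ 𝓝 x := Icc_mem_nhds hx.1 hx.2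
    refine ⟨(hf.differentiableOn one_ne_zero x (Ioo_subset_Icc_self hx)).differentiableAt hx', ?_⟩
    rw [← derivWithin_of_mem_nhds hx']
    exact hC x (Ioo_subset_Icc_self hx)
  · exact ⟨0, fun x hx => absurd (hx.1.trans hx.2) hab.not_gt⟩

namespace IsClosedPiecewiseC1

variable {γ : ℝ → ℂ}

theorem continuousOn (h : IsClosedPiecewiseC1 γ) : ContinuousOn γ (Icc 0 1) := by
  obtain ⟨-, m, t, ht, h0, h1, hC⟩ := h
  refine (LocallyFinite.continuousOn_iUnion
    (locallyFinite_of_finite fun i : Fin m => Icc (t i.castSucc) (t i.succ))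
    (fun i => isClosed_Icc) (fun i => (hC i).continuousOn)).mono fun x hx => mem_iUnion.2 ?_
  rcases hx.1.eq_or_lt with rfl | hx0
  · obtain ⟨i, -⟩ := exists_mem_Ioc_castSucc_succ t (Fin.last m) (h0.trans_lt one_pos) h1.ge
    have : NeZero m := ⟨i.pos.ne'⟩
    exact ⟨0, h0.le, h0.ge.trans (ht (Fin.zero_le _))⟩
  · obtain ⟨i, hi⟩ :=
      exists_mem_Ioc_castSucc_succ t (Fin.last m) (h0.trans_lt hx0) (hx.2.trans h1.ge)
    exact ⟨i, Ioc_subset_Icc_self hi⟩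

theorem isCompact_image (h : IsClosedPiecewiseC1 γ) : IsCompact (γ '' Icc 0 1) :=
  isCompact_Icc.image_of_continuousOn h.continuousOn

theorem exists_bound_deriv (h : IsClosedPiecewiseC1 γ) : ∃ (s : Set ℝ) (C : ℝ), s.Countable ∧
    ∀ x ∈ Icc (0 : ℝ) 1 \ s, DifferentiableAt ℝ γ x ∧ ‖deriv γ x‖ ≤ C := by
  obtain ⟨-, m, t, -, h0, h1, hC⟩ := h
  choose C hC' using fun i => exists_bound_deriv_of_contDiffOn_Icc (hC i)
  refine ⟨range t, ∑ i, |C i|, (finite_range t).countable, fun x hx => ?_⟩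
  have hx0 : t 0 < x := (h0.trans_le hx.1.1).lt_of_ne fun e => hx.2 ⟨0, e⟩
  obtain ⟨i, hi⟩ := exists_mem_Ioc_castSucc_succ t (Fin.last m) hx0 (hx.1.2.trans h1.ge)
  obtain ⟨hd, hle⟩ := hC' i x ⟨hi.1, hi.2.lt_of_ne fun e => hx.2 ⟨_, e.symm⟩⟩
  refine ⟨hd, hle.trans ((le_abs_self _).trans ?_)⟩
  exact Finset.single_le_sum (f := fun i => |C i|) (fun _ _ => abs_nonneg _) (Finset.mem_univ i)

theorem exists_ae_bound_deriv (h : IsClosedPiecewiseC1 γ) :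
    ∃ C : ℝ, 0 ≤ C ∧ ∀ᵐ x, x ∈ uIoc (0 : ℝ) 1 → ‖deriv γ x‖ ≤ C := by
  obtain ⟨s, C, hs, hC⟩ := h.exists_bound_deriv
  refine ⟨|C|, abs_nonneg _, ?_⟩
  filter_upwards [hs.ae_notMem volume] with x hx hx'
  rw [uIoc_of_le zero_le_one] at hx'
  exact (hC x ⟨Ioc_subset_Icc_self hx', hx⟩).2.trans (le_abs_self C)

theorem intervalIntegrable_deriv (h : IsClosedPiecewiseC1 γ) :
    IntervalIntegrable (deriv γ) volume 0 1 := by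
  obtain ⟨C, -, hC⟩ := h.exists_ae_bound_deriv
  rw [intervalIntegrable_iff]
  refine Measure.integrableOn_of_bounded (M := C) (by simp)
    (measurable_deriv γ).aestronglyMeasurable ?_
  rwa [ae_restrict_iff' measurableSet_uIoc]

variable {E : Type*} [NormedAddCommGroup E] [NormedSpace ℂ E]

theorem intervalIntegrable_deriv_smul (h : IsClosedPiecewiseC1 γ) {F : ℂ → E}
    (hF : ContinuousOn F (γ '' Icc 0 1)) :
    IntervalIntegrable (fun t => deriv γ t • F (γ t)) volume 0 1 :=
  h.intervalIntegrable_deriv.smul_continuousOn <| by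
    rw [uIcc_of_le zero_le_one]
    exact hF.comp h.continuousOn (mapsTo_image γ _)

end IsClosedPiecewiseC1

/-! ### Contour integrals -/

section ContourIntegral

variable {E : Type*} [NormedAddCommGroup E] [NormedSpace ℂ E]

/-- The contour integral `∮_γ F(z) dz` along a curve parametrized by `[0, 1]`. -/
def contourIntegral (γ : ℝ → ℂ) (F : ℂ → E) : E := ∫ t in (0 : ℝ)..1, deriv γ t • F (γ t)

variable {γ : ℝ → ℂ} {F G : ℂ → E}

theorem contourIntegral_congr (h : EqOn F G (γ '' Icc 0 1)) :
    contourIntegral γ F = contourIntegral γ G := by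
  refine intervalIntegral.integral_congr fun t ht => ?_
  rw [uIcc_of_le zero_le_one] at ht
  simp only [h (mem_image_of_mem γ ht)]

theorem contourIntegral_smul_const [CompleteSpace E] (γ : ℝ → ℂ) (f : ℂ → ℂ) (c : E) :
    contourIntegral γ (fun z => f z • c) = contourIntegral γ f • c := by
  simp only [contourIntegral, ← intervalIntegral.integral_smul_const, smul_assoc]

theorem contourIntegral_inv_sub (γ : ℝ → ℂ) (w : ℂ) :
    contourIntegral γ (fun z => (z - w)⁻¹) = 2 * Real.pi * Complex.I * windingNumber γ w := by
  rw [windingNumber, mul_inv_cancel_left₀ Complex.two_pi_I_ne_zero]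
  rfl

theorem IsClosedPiecewiseC1.contourIntegral_sub (h : IsClosedPiecewiseC1 γ)
    (hF : ContinuousOn F (γ '' Icc 0 1)) (hG : ContinuousOn G (γ '' Icc 0 1)) :
    contourIntegral γ (fun z => F z - G z) = contourIntegral γ F - contourIntegral γ G := by
  simp only [contourIntegral, smul_sub]
  exact intervalIntegral.integral_sub (h.intervalIntegrable_deriv_smul hF)
    (h.intervalIntegrable_deriv_smul hG)

theorem IsClosedPiecewiseC1.contourIntegral_clm_comp {E' : Type*} [NormedAddCommGroup E']
    [NormedSpace ℂ E'] [CompleteSpace E] [CompleteSpace E'] (h : IsClosedPiecewiseC1 γ)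
    (hF : ContinuousOn F (γ '' Icc 0 1)) (L : E →L[ℂ] E') :
    contourIntegral γ (fun z => L (F z)) = L (contourIntegral γ F) := by
  rw [contourIntegral, contourIntegral,
    ← L.intervalIntegral_comp_comm (h.intervalIntegrable_deriv_smul hF)]
  simp only [map_smul]

theorem IsClosedPiecewiseC1.contourIntegral_pow (h : IsClosedPiecewiseC1 γ) (m : ℕ) :
    contourIntegral γ (fun z => z ^ m) = 0 := by
  obtain ⟨s, C, hs, hC⟩ := h.exists_bound_deriv
  have hm : (m + 1 : ℂ) ≠ 0 := by exact_mod_cast m.succ_ne_zero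
  have hderiv : ∀ x ∈ Ioo (0 : ℝ) 1 \ s,
      HasDerivAt (fun t => (m + 1 : ℂ)⁻¹ * γ t ^ (m + 1)) (deriv γ x • γ x ^ m) x := by
    intro x hx
    have hγ := (hC x ⟨Ioo_subset_Icc_self hx.1, hx.2⟩).1.hasDerivAt
    refine ((hγ.pow (m + 1)).const_mul (m + 1 : ℂ)⁻¹).congr_deriv ?_
    push_cast
    field_simp
    rw [smul_eq_mul, mul_comm]
  have hcont : ContinuousOn (fun t => (m + 1 : ℂ)⁻¹ * γ t ^ (m + 1)) (Icc 0 1) :=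
    continuousOn_const.mul (h.continuousOn.pow _)
  rw [contourIntegral, integral_eq_of_hasDerivAt_off_countable_of_le _ _ zero_le_one hs hcont hderiv
    (h.intervalIntegrable_deriv_smul (continuous_pow m).continuousOn), h.1, sub_self]

/-- The Cauchy transform `w ↦ ∮_γ F(z) / (z - w) dz` of a function `F` on the curve `γ`. -/
def cauchyTransform (γ : ℝ → ℂ) (F : ℂ → E) (w : ℂ) : E :=
  contourIntegral γ fun z => (z - w)⁻¹ • F z

theorem continuousOn_inv_sub {S : Set ℂ} {w : ℂ} (hw : w ∉ S) :
    ContinuousOn (fun z => (z - w)⁻¹) S :=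
  (continuousOn_id.sub continuousOn_const).inv₀ fun z hz h => hw ((sub_eq_zero.1 h : z = w) ▸ hz)

theorem IsClosedPiecewiseC1.differentiableOn_cauchyTransform (h : IsClosedPiecewiseC1 γ)
    (hF : ContinuousOn F (γ '' Icc 0 1)) :
    DifferentiableOn ℂ (cauchyTransform γ F) (γ '' Icc 0 1)ᶜ := by
  intro w₀ hw₀
  refine DifferentiableAt.differentiableWithinAt ?_
  obtain ⟨δ, hδ, hball⟩ := Metric.isOpen_iff.1 h.isCompact_image.isClosed.isOpen_compl w₀ hw₀
  have hfar : ∀ w ∈ Metric.ball w₀ (δ / 2), ∀ z ∈ γ '' Icc 0 1, δ / 2 ≤ ‖z - w‖ := by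
    intro w hw z hz
    have hzδ : δ ≤ dist z w₀ := not_lt.1 fun hlt => hball hlt hz
    rw [← dist_eq_norm]
    linarith [dist_triangle z w w₀, Metric.mem_ball.1 hw]
  have hne : ∀ w ∈ Metric.ball w₀ (δ / 2), w ∉ γ '' Icc 0 1 := fun w hw =>
    hball (Metric.ball_subset_ball (half_le_self hδ.le) hw)
  have hint : ∀ w ∈ Metric.ball w₀ (δ / 2), ∀ k : ℕ,
      IntervalIntegrable (fun t => deriv γ t • ((γ t - w)⁻¹ ^ k • F (γ t))) volume 0 1 :=
    fun w hw k =>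
      h.intervalIntegrable_deriv_smul (((continuousOn_inv_sub (hne w hw)).pow k).smul hF)
  have hw₀' : w₀ ∈ Metric.ball w₀ (δ / 2) := Metric.mem_ball_self (half_pos hδ)
  have hmem : ∀ t ∈ uIoc (0 : ℝ) 1, γ t ∈ γ '' Icc 0 1 := fun t ht =>
    mem_image_of_mem γ (Ioc_subset_Icc_self (uIoc_of_le (zero_le_one (α := ℝ)) ▸ ht))
  obtain ⟨C, hC0, hC⟩ := h.exists_ae_bound_deriv
  obtain ⟨K, hK⟩ := h.isCompact_image.exists_bound_of_continuousOn hF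
  refine (intervalIntegral.hasDerivAt_integral_of_dominated_loc_of_deriv_le
    (F' := fun w t => deriv γ t • ((γ t - w)⁻¹ ^ 2 • F (γ t)))
    (bound := fun _ => C * ((δ / 2)⁻¹ ^ 2 * K)) (Metric.ball_mem_nhds w₀ (half_pos hδ)) ?_
    (by simpa only [pow_one] using hint w₀ hw₀' 1)
    (hint w₀ hw₀' 2).aestronglyMeasurable_restrict_uIoc ?_ intervalIntegrable_const
    ?_).2.differentiableAt
  · filter_upwards [Metric.ball_mem_nhds w₀ (half_pos hδ)] with w hw
    simpa only [pow_one] using (hint w hw 1).aestronglyMeasurable_restrict_uIoc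
  · filter_upwards [hC] with t hCt ht w hw
    rw [norm_smul, norm_smul, norm_pow, norm_inv]
    have := hfar w hw _ (hmem t ht)
    have := hK _ (hmem t ht)
    have := hCt ht
    gcongr
  · filter_upwards with t ht w hw
    have hsub : γ t - w ≠ 0 := fun e => hne w hw (sub_eq_zero.1 e ▸ hmem t ht)
    have hinv : HasDerivAt (fun w => (γ t - w)⁻¹) ((γ t - w)⁻¹ ^ 2) w :=
      (((hasDerivAt_id w).const_sub (γ t)).inv hsub).congr_deriv (by simp)
    exact (hinv.smul_const (F (γ t))).const_smul _

end ContourIntegral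

/-! ### The Cauchy integral of the resolvent -/

section Cycle

theorem eqOn_zero_of_eqOn_inter_of_tendsto_cobounded {E : Type*} [NormedAddCommGroup E]
    [NormedSpace ℂ E] {U W : Set ℂ} {G H : ℂ → E} (hU : IsOpen U) (hUb : Bornology.IsBounded U)
    (hW : IsOpen W) (hUW : Uᶜ ⊆ W) (hG : DifferentiableOn ℂ G U) (hH : DifferentiableOn ℂ H W)
    (hGH : EqOn G H (U ∩ W)) (hH0 : Tendsto H (Bornology.cobounded ℂ) (𝓝 0)) : EqOn H 0 W := by
  classical
  set F : ℂ → E := U.piecewise G H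
  have hFU : EqOn F G U := U.piecewise_eqOn G H
  have hFW : EqOn F H W := fun z hz => by
    by_cases hzU : z ∈ U
    · exact (hFU hzU).trans (hGH ⟨hzU, hz⟩)
    · exact U.piecewise_eq_of_notMem G H hzU
  have hF : Differentiable ℂ F := fun z => by
    by_cases hz : z ∈ U
    · exact (hG.congr hFU).differentiableAt (hU.mem_nhds hz)
    · exact (hH.congr hFW).differentiableAt (hW.mem_nhds (hUW hz))
  have hF0 : Tendsto F (cocompact ℂ) (𝓝 0) := by
    rw [← Metric.cobounded_eq_cocompact]
    have hUc : Uᶜ ∈ Bornology.cobounded ℂ := hUb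
    exact hH0.congr' (eventually_of_mem hUc fun z hz => (hFW (hUW hz)).symm)
  exact fun z hz => (hFW hz).symm.trans (hF.apply_eq_of_tendsto_cocompact z hF0)

/-- The curves `γ k` form a cycle off the bounded open set `U` that winds once around each of its
points. -/
structure IsCycleAround {ι : Type*} [Fintype ι] (γ : ι → ℝ → ℂ) (U : Set ℂ) : Prop where
  isClosedPiecewiseC1 : ∀ k, IsClosedPiecewiseC1 (γ k)
  isOpen : IsOpen U
  isBounded : Bornology.IsBounded U
  image_subset_compl : ∀ k, γ k '' Icc 0 1 ⊆ Uᶜ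
  sum_windingNumber : ∀ w ∈ U, ∑ k, windingNumber (γ k) w = 1

variable {B : Type*} [NormedRing B] [NormedAlgebra ℂ B] {a : B}

theorem resolvent_sub_resolvent_eq_smul {w z : ℂ} (hw : w ∈ resolventSet ℂ a)
    (hz : z ∈ resolventSet ℂ a) :
    resolvent a w - resolvent a z = (z - w) • (resolvent a w * resolvent a z) := by
  rw [resolvent, resolvent, Ring.inverse_sub_inverse (iff_of_true hw hz), sub_sub_sub_cancel_right,
    ← map_sub, ← Algebra.commutes, ← Algebra.smul_def, smul_mul_assoc]

theorem IsCycleAround.image_subset_resolventSet {ι : Type*} [Fintype ι] {γ : ι → ℝ → ℂ} {U : Set ℂ}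
    (h : IsCycleAround γ U) (ha : spectrum ℂ a ⊆ U) (k : ι) :
    γ k '' Icc 0 1 ⊆ resolventSet ℂ a :=
  (h.image_subset_compl k).trans (compl_subset_comm.1 ha)

variable [CompleteSpace B]

theorem differentiableOn_resolvent (a : B) : DifferentiableOn ℂ (resolvent a) (resolventSet ℂ a) :=
  fun _ hz => (spectrum.hasDerivAt_resolvent_const_left hz).differentiableAt.differentiableWithinAt

theorem continuousOn_resolvent (a : B) : ContinuousOn (resolvent a) (resolventSet ℂ a) :=
  (differentiableOn_resolvent a).continuousOn

theorem IsClosedPiecewiseC1.cauchyTransform_resolvent {γ : ℝ → ℂ} (h : IsClosedPiecewiseC1 γ)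
    (hγ : γ '' Icc 0 1 ⊆ resolventSet ℂ a) {w : ℂ} (hw : w ∈ resolventSet ℂ a)
    (hwγ : w ∉ γ '' Icc 0 1) :
    cauchyTransform γ (resolvent a) w
      = (2 * Real.pi * Complex.I * windingNumber γ w) • resolvent a w
        - contourIntegral γ (resolvent a) * resolvent a w := by
  have hres := (continuousOn_resolvent a).mono hγ
  have hinv : ContinuousOn (fun z => (z - w)⁻¹ • resolvent a w) (γ '' Icc 0 1) :=
    (continuousOn_inv_sub hwγ).smul continuousOn_const
  have hmul : ContinuousOn (fun z => resolvent a z * resolvent a w) (γ '' Icc 0 1) :=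
    hres.mul continuousOn_const
  have hsplit : EqOn (fun z => (z - w)⁻¹ • resolvent a z)
      (fun z => (z - w)⁻¹ • resolvent a w - resolvent a z * resolvent a w) (γ '' Icc 0 1) := by
    intro z hz
    have hzw : z - w ≠ 0 := fun e => hwγ (sub_eq_zero.1 e ▸ hz)
    simp only
    rw [← sub_eq_zero, sub_sub_eq_add_sub, add_sub_right_comm, ← smul_sub,
      resolvent_sub_resolvent_eq_smul (hγ hz) hw, smul_smul, ← neg_sub z w, mul_neg,
      inv_mul_cancel₀ hzw, neg_one_smul, neg_add_cancel]
  rw [cauchyTransform, contourIntegral_congr hsplit, h.contourIntegral_sub hinv hmul,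
    contourIntegral_smul_const, contourIntegral_inv_sub]
  congr 1
  exact h.contourIntegral_clm_comp hres ((ContinuousLinearMap.mul ℂ B).flip (resolvent a w))

variable {ι : Type*} [Fintype ι] {γ : ι → ℝ → ℂ} {U : Set ℂ}

namespace IsCycleAround

theorem sum_cauchyTransform_resolvent (h : IsCycleAround γ U) (ha : spectrum ℂ a ⊆ U) {w : ℂ}
    (hwU : w ∈ U) (hw : w ∈ resolventSet ℂ a) :
    ∑ k, cauchyTransform (γ k) (resolvent a) w
      = ((2 * Real.pi * Complex.I : ℂ) • 1 - ∑ k, contourIntegral (γ k) (resolvent a))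
        * resolvent a w := by
  have hk : ∀ k, cauchyTransform (γ k) (resolvent a) w
      = (2 * Real.pi * Complex.I * windingNumber (γ k) w) • resolvent a w
        - contourIntegral (γ k) (resolvent a) * resolvent a w := fun k =>
    (h.isClosedPiecewiseC1 k).cauchyTransform_resolvent (h.image_subset_resolventSet ha k) hw
      fun hmem => h.image_subset_compl k hmem hwU
  rw [Finset.sum_congr rfl fun k _ => hk k, Finset.sum_sub_distrib, ← Finset.sum_smul,
    ← Finset.mul_sum, h.sum_windingNumber w hwU, ← Finset.sum_mul, sub_mul, mul_one,
    smul_mul_assoc, one_mul]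

/- On `U` off the spectrum the Cauchy transform of the resolvent is `(2πi - P)` times the resolvent,
where `P` is the integral to be computed. The two functions glue to an entire function that vanishes
at infinity, so `(2πi - P)` annihilates the resolvent, which is invertible. -/
theorem sum_contourIntegral_resolvent (h : IsCycleAround γ U) (ha : spectrum ℂ a ⊆ U) :
    ∑ k, contourIntegral (γ k) (resolvent a) = (2 * Real.pi * Complex.I : ℂ) • (1 : B) := by
  set Q : B := (2 * Real.pi * Complex.I : ℂ) • 1 - ∑ k, contourIntegral (γ k) (resolvent a)
    with hQ
  have hG : DifferentiableOn ℂ (fun w => ∑ k, cauchyTransform (γ k) (resolvent a) w) U :=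
    DifferentiableOn.fun_sum fun k _ => ((h.isClosedPiecewiseC1 k).differentiableOn_cauchyTransform
      ((continuousOn_resolvent a).mono (h.image_subset_resolventSet ha k))).mono
      (subset_compl_comm.1 (h.image_subset_compl k))
  have hlim := (spectrum.resolvent_tendsto_cobounded (𝕜 := ℂ) a).const_mul Q
  rw [mul_zero] at hlim
  have hzero : EqOn (fun z => Q * resolvent a z) 0 (resolventSet ℂ a) :=
    eqOn_zero_of_eqOn_inter_of_tendsto_cobounded h.isOpen h.isBounded
      (spectrum.isOpen_resolventSet a) (compl_subset_comm.1 ha) hG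
      ((differentiableOn_const Q).mul (differentiableOn_resolvent a))
      (fun w hw => h.sum_cauchyTransform_resolvent ha hw.1 hw.2) hlim
  obtain ⟨z, hz⟩ := (spectrum.eventually_isUnit_resolvent (𝕜 := ℂ) a).exists
  have hQ0 : Q = 0 := hz.mul_left_eq_zero.1 (hzero (spectrum.isUnit_resolvent.2 hz))
  exact (sub_eq_zero.1 (hQ.symm.trans hQ0)).symm

end IsCycleAround

theorem IsClosedPiecewiseC1.contourIntegral_pow_succ_smul_resolvent {γ : ℝ → ℂ}
    (h : IsClosedPiecewiseC1 γ) (hγ : γ '' Icc 0 1 ⊆ resolventSet ℂ a) (m : ℕ) :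
    contourIntegral γ (fun z => z ^ (m + 1) • resolvent a z)
      = a * contourIntegral γ (fun z => z ^ m • resolvent a z) := by
  have hcont (m : ℕ) : ContinuousOn (fun z => z ^ m • resolvent a z) (γ '' Icc 0 1) :=
    (continuous_pow m).continuousOn.smul ((continuousOn_resolvent a).mono hγ)
  have hone : ContinuousOn (fun z : ℂ => z ^ m • (1 : B)) (γ '' Icc 0 1) :=
    (continuous_pow m).continuousOn.smul continuousOn_const
  have hsplit : EqOn (fun z => a * (z ^ m • resolvent a z))
      (fun z => z ^ (m + 1) • resolvent a z - z ^ m • (1 : B)) (γ '' Icc 0 1) := by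
    intro z hz
    have hinv : (algebraMap ℂ B z - a) * resolvent a z = 1 := Ring.mul_inverse_cancel _ (hγ hz)
    simp only
    rw [← hinv, sub_mul, ← Algebra.smul_def, smul_sub, smul_smul, ← pow_succ, sub_sub_cancel,
      mul_smul_comm]
  have hleft := h.contourIntegral_clm_comp (hcont m) (ContinuousLinearMap.mul ℂ B a)
  simp only [ContinuousLinearMap.mul_apply'] at hleft
  rw [← hleft, contourIntegral_congr hsplit, h.contourIntegral_sub
    (hcont (m + 1)) hone, contourIntegral_smul_const,
    h.contourIntegral_pow, zero_smul, sub_zero]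

theorem IsCycleAround.sum_contourIntegral_pow_smul_resolvent (h : IsCycleAround γ U)
    (ha : spectrum ℂ a ⊆ U) (m : ℕ) :
    ∑ k, contourIntegral (γ k) (fun z => z ^ m • resolvent a z)
      = (2 * Real.pi * Complex.I : ℂ) • a ^ m := by
  induction m with
  | zero => simpa only [pow_zero, one_smul] using h.sum_contourIntegral_resolvent ha
  | succ m ih =>
    rw [Finset.sum_congr rfl fun k _ => (h.isClosedPiecewiseC1 k)
      |>.contourIntegral_pow_succ_smul_resolvent (h.image_subset_resolventSet ha k) m,
      ← Finset.mul_sum, ih, mul_smul_comm, pow_succ']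

end Cycle

/-! ### Banach algebras with a contractive representation of `ℂ` -/

section BanachAlgebra

theorem eventually_norm_pow_le_of_spectrum_subset_ball {B : Type*} [NormedRing B]
    [NormedAlgebra ℂ B] [CompleteSpace B] {a : B} {ρ : ℝ} (hρ : 0 < ρ)
    (ha : spectrum ℂ a ⊆ Metric.ball 0 ρ) : ∀ᶠ m in atTop, ‖a ^ m‖ ≤ ρ ^ m := by
  rcases subsingleton_or_nontrivial B with _ | _
  · exact .of_forall fun m => by
      rw [Subsingleton.elim (a ^ m) 0, norm_zero]
      positivity
  lift ρ to NNReal using hρ.le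
  have hrad : spectralRadius ℂ a < ρ := spectrum.spectralRadius_lt_of_forall_lt a fun z hz => by
    simpa [← NNReal.coe_lt_coe] using ha hz
  have hroot := spectrum.pow_nnnorm_pow_one_div_tendsto_nhds_spectralRadius a
  filter_upwards [hroot.eventually_lt_const hrad, eventually_gt_atTop 0] with m hm hm0
  have hm0' : (0 : ℝ) < m := Nat.cast_pos.2 hm0
  rw [one_div, ENNReal.rpow_inv_lt_iff hm0', ENNReal.rpow_natCast] at hm
  exact_mod_cast hm.le

theorem resolvent_eq_inverse_mul {R B : Type*} [CommRing R] [Ring B] [Algebra R B] {a : B}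
    {z w : R} (h : IsUnit ((algebraMap R B z - a) * (algebraMap R B w - a))) :
    z ∈ resolventSet R a ∧ resolvent a z =
      Ring.inverse ((algebraMap R B z - a) * (algebraMap R B w - a)) *
        (algebraMap R B w - a) := by
  have hcomm : Commute (algebraMap R B z - a) (algebraMap R B w - a) :=
    ((Algebra.commute_algebraMap_left z _).sub_left
      ((Algebra.commute_algebraMap_right w a).sub_right (Commute.refl a)))
  obtain ⟨hz, hw⟩ := hcomm.isUnit_mul_iff.1 h
  refine ⟨hz, ?_⟩
  rw [hcomm.eq, Ring.mul_inverse_rev' hcomm.symm, mul_assoc, Ring.inverse_mul_cancel _ hw, mul_one,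
    resolvent]

variable {A : Type*} [NormedRing A]

theorem norm_mul_pow_le (x y : A) (m : ℕ) : ‖x * y ^ m‖ ≤ ‖x‖ * ‖y‖ ^ m := by
  induction m with
  | zero => simp
  | succ m ih =>
    rw [pow_succ, ← mul_assoc, pow_succ, ← mul_assoc]
    exact (norm_mul_le _ _).trans (mul_le_mul_of_nonneg_right ih (norm_nonneg y))

variable [NormedAlgebra ℝ A]

theorem hasSum_intervalIntegral_mul_pow_mul [CompleteSpace A] {K g S : ℝ → A} {a b ρ : ℝ}
    {c : ℕ → A} (hK : IntervalIntegrable K volume a b) (hg : ContinuousOn g (uIcc a b))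
    (hρ : ∀ t ∈ uIcc a b, ‖g t‖ ≤ ρ) (hc : Summable fun m => ρ ^ m * ‖c m‖)
    (hS : ∀ t ∈ uIcc a b, HasSum (fun m => g t ^ m * c m) (S t)) :
    HasSum (fun m => (∫ t in a..b, K t * g t ^ m) * c m) (∫ t in a..b, K t * S t) := by
  have hint : ∀ m, IntervalIntegrable (fun t => K t * g t ^ m) volume a b := fun m =>
    hK.mul_continuousOn (hg.pow m)
  have hterm : ∀ m, (∫ t in a..b, K t * g t ^ m) * c m = ∫ t in a..b, K t * g t ^ m * c m :=
    fun m => (((ContinuousLinearMap.mul ℝ A).flip (c m)).intervalIntegral_comp_comm (hint m)).symm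
  simp only [hterm]
  refine intervalIntegral.hasSum_integral_of_dominated_convergence
    (fun m t => ‖K t‖ * (ρ ^ m * ‖c m‖)) (fun m => ?_) (fun m => ?_) ?_ ?_ ?_
  · exact ((hint m).mul_const _).aestronglyMeasurable_restrict_uIoc
  · refine .of_forall fun t ht => ?_
    rw [← mul_assoc]
    have hnorm := hρ t (uIoc_subset_uIcc ht)
    calc ‖K t * g t ^ m * c m‖ ≤ ‖K t‖ * ‖g t‖ ^ m * ‖c m‖ :=
          (norm_mul_le _ _).trans (by gcongr; exact norm_mul_pow_le _ _ _)
      _ ≤ ‖K t‖ * ρ ^ m * ‖c m‖ := by gcongr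
  · exact .of_forall fun t _ => hc.mul_left _
  · simp only [tsum_mul_left]
    exact hK.norm.mul_const _
  · refine .of_forall fun t ht => ?_
    simpa only [mul_assoc] using (hS t (uIoc_subset_uIcc ht)).mul_left (K t)

end BanachAlgebra

/-- A contractive homomorphism of real algebras from `ℂ`. It makes a real Banach algebra a complex
Banach space on which the left multiplications act complex linearly. -/
structure ContractiveRep (A : Type*) [NormedRing A] [NormedAlgebra ℝ A] where
  /-- the homomorphism -/
  hom : ℂ →ₐ[ℝ] A
  norm_le : ∀ z, ‖hom z‖ ≤ ‖z‖

namespace ContractiveRep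

variable {A : Type*} [NormedRing A] [NormedAlgebra ℝ A] (φ : ContractiveRep A)

theorem continuous_hom : Continuous φ.hom :=
  AddMonoidHomClass.continuous_of_bound φ.hom 1 fun z => by simpa only [one_mul] using φ.norm_le z

/-- The algebra `A` as a complex Banach space, with `z • X = X * φ z`. It is a type synonym because
the real scalar multiplication it induces is not definitionally the one of `A`. -/
def RightModule (_ : ContractiveRep A) : Type _ := A

instance : NormedAddCommGroup φ.RightModule := inferInstanceAs (NormedAddCommGroup A)

instance [CompleteSpace A] : CompleteSpace φ.RightModule := inferInstanceAs (CompleteSpace A)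

/-- The identification of the complex Banach space with `A`. -/
def toAlgebra : φ.RightModule ≃+ A := AddEquiv.refl A

theorem continuous_toAlgebra : Continuous φ.toAlgebra := continuous_id

theorem norm_toAlgebra (X : φ.RightModule) : ‖φ.toAlgebra X‖ = ‖X‖ := rfl

instance : SMul ℂ φ.RightModule := ⟨fun z X => φ.toAlgebra.symm (φ.toAlgebra X * φ.hom z)⟩

theorem toAlgebra_smul (z : ℂ) (X : φ.RightModule) :
    φ.toAlgebra (z • X) = φ.toAlgebra X * φ.hom z := rfl

instance : Module ℂ φ.RightModule where
  one_smul X := φ.toAlgebra.injective (by simp [toAlgebra_smul])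
  mul_smul z w X := φ.toAlgebra.injective (by simp [toAlgebra_smul, mul_comm z w, mul_assoc])
  smul_zero z := φ.toAlgebra.injective (by simp [toAlgebra_smul])
  smul_add z X Y := φ.toAlgebra.injective (by simp [toAlgebra_smul, add_mul])
  add_smul z w X := φ.toAlgebra.injective (by simp [toAlgebra_smul, mul_add])
  zero_smul X := φ.toAlgebra.injective (by simp [toAlgebra_smul])

instance : NormedSpace ℂ φ.RightModule where
  norm_smul_le z X := by
    rw [← norm_toAlgebra, toAlgebra_smul, mul_comm, ← norm_toAlgebra]
    exact (norm_mul_le _ _).trans (by gcongr; exact φ.norm_le z)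

/-- Left multiplication, as a homomorphism to the complex Banach algebra of operators. -/
def mulLeft : A →+* (φ.RightModule →L[ℂ] φ.RightModule) where
  toFun T := LinearMap.mkContinuous
    { toFun := fun X => φ.toAlgebra.symm (T * φ.toAlgebra X)
      map_add' := fun X Y => φ.toAlgebra.injective (by simp [mul_add])
      map_smul' := fun z X => φ.toAlgebra.injective (by simp [toAlgebra_smul, mul_assoc]) }
    ‖T‖ fun X => norm_mul_le T (φ.toAlgebra X)
  map_one' := ContinuousLinearMap.ext fun X => one_mul (φ.toAlgebra X)
  map_mul' S T := ContinuousLinearMap.ext fun X => mul_assoc S T (φ.toAlgebra X)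
  map_zero' := ContinuousLinearMap.ext fun X => zero_mul (φ.toAlgebra X)
  map_add' S T := ContinuousLinearMap.ext fun X => add_mul S T (φ.toAlgebra X)

theorem toAlgebra_mulLeft (T : A) (X : φ.RightModule) :
    φ.toAlgebra (φ.mulLeft T X) = T * φ.toAlgebra X := rfl

theorem mulLeft_real_smul (r : ℝ) (T : A) : φ.mulLeft (r • T) = (r : ℂ) • φ.mulLeft T := by
  refine ContinuousLinearMap.ext fun X => φ.toAlgebra.injective ?_
  rw [smul_apply, toAlgebra_smul, toAlgebra_mulLeft, toAlgebra_mulLeft,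
    ← Complex.coe_algebraMap, φ.hom.commutes, ← Algebra.commutes, ← Algebra.smul_def,
    smul_mul_assoc]

/-- `T² - 2 Re[z] T + |z|²`. -/
def quadratic (T : A) (z : ℂ) : A := T ^ 2 - (2 * z.re) • T + (‖z‖ ^ 2) • (1 : A)

/-- The abstract `S`-resolvent `-(T² - 2 Re[z] T + |z|²)⁻¹ (T - z̄)`. -/
def sResolvent (T : A) (z : ℂ) : A :=
  -(Ring.inverse (quadratic T z) * (T - φ.hom (starRingEnd ℂ z)))

theorem mulLeft_quadratic (T : A) (z : ℂ) :
    φ.mulLeft (quadratic T z) = (algebraMap ℂ _ z - φ.mulLeft T)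
      * (algebraMap ℂ _ (starRingEnd ℂ z) - φ.mulLeft T) := by
  have hadd : ((2 * z.re : ℝ) : ℂ) = z + starRingEnd ℂ z := (Complex.add_conj z).symm
  have hmul : ((‖z‖ ^ 2 : ℝ) : ℂ) = z * starRingEnd ℂ z := by
    rw [Complex.mul_conj, Complex.normSq_eq_norm_sq]
  rw [quadratic, map_add, map_sub, map_pow, mulLeft_real_smul, mulLeft_real_smul, map_one, hadd,
    hmul, ← Algebra.algebraMap_eq_smul_one, Algebra.smul_def, map_add, map_mul, add_mul, sub_mul,
    mul_sub, mul_sub, ← Algebra.commutes (starRingEnd ℂ z) (φ.mulLeft T), sq]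
  abel

theorem resolvent_mulLeft {T : A} {z : ℂ} (hz : IsUnit (quadratic T z)) :
    z ∈ resolventSet ℂ (φ.mulLeft T) ∧
      φ.toAlgebra (resolvent (φ.mulLeft T) z (φ.toAlgebra.symm 1)) = φ.sResolvent T z := by
  have hinv : Ring.inverse (φ.mulLeft (quadratic T z))
      = φ.mulLeft (Ring.inverse (quadratic T z)) := by
    obtain ⟨u, hu⟩ := hz
    rw [← hu, Ring.inverse_unit]
    exact Ring.inverse_unit (Units.map φ.mulLeft.toMonoidHom u)
  have hunit := hz.map φ.mulLeft
  rw [mulLeft_quadratic] at hunit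
  obtain ⟨hmem, hres⟩ := resolvent_eq_inverse_mul hunit
  refine ⟨hmem, ?_⟩
  rw [hres, ← mulLeft_quadratic, hinv, mul_apply_eq_comp, toAlgebra_mulLeft,
    sResolvent, ← mul_neg, neg_sub]
  simp [toAlgebra_mulLeft, toAlgebra_smul, Algebra.algebraMap_eq_smul_one]

/-- Evaluation at the unit of `A`. -/
def evalOne : (φ.RightModule →L[ℂ] φ.RightModule) →L[ℝ] A :=
  (φ.toAlgebra.toAddMonoidHom.comp
      { toFun := fun X : φ.RightModule →L[ℂ] φ.RightModule => X (φ.toAlgebra.symm 1)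
        map_zero' := rfl
        map_add' := fun _ _ => rfl }).toRealLinearMap
    (φ.continuous_toAlgebra.comp
      (ContinuousLinearMap.apply ℂ φ.RightModule (φ.toAlgebra.symm 1)).continuous)

theorem evalOne_apply (X : φ.RightModule →L[ℂ] φ.RightModule) :
    φ.evalOne X = φ.toAlgebra (X (φ.toAlgebra.symm 1)) := rfl

variable {T : A} {U : Set ℂ}

theorem spectrum_mulLeft_subset (hT : ∀ z ∉ U, IsUnit (quadratic T z)) :
    spectrum ℂ (φ.mulLeft T) ⊆ U :=
  fun z hz => by_contra fun hzU => hz (φ.resolvent_mulLeft (hT z hzU)).1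

variable [CompleteSpace A]

theorem continuousOn_sResolvent (T : A) :
    ContinuousOn (φ.sResolvent T) {z | IsUnit (quadratic T z)} := by
  have hres : ContinuousOn (resolvent (φ.mulLeft T)) {z | IsUnit (quadratic T z)} :=
    (continuousOn_resolvent (φ.mulLeft T)).mono fun z hz => (φ.resolvent_mulLeft hz).1
  exact (φ.continuous_toAlgebra.comp_continuousOn (hres.clm_apply continuousOn_const)).congr
    fun z hz => (φ.resolvent_mulLeft hz).2.symm

theorem eventually_norm_pow_le (φ : ContractiveRep A) {ρ : ℝ} (hρ : 0 < ρ)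
    (hT : ∀ z ∉ Metric.ball (0 : ℂ) ρ, IsUnit (quadratic T z)) :
    ∀ᶠ m in atTop, ‖T ^ m‖ ≤ ρ ^ m * ‖(1 : A)‖ := by
  filter_upwards [eventually_norm_pow_le_of_spectrum_subset_ball hρ
    (φ.spectrum_mulLeft_subset hT)] with m hm
  have hT1 : φ.toAlgebra ((φ.mulLeft T ^ m) (φ.toAlgebra.symm 1)) = T ^ m := by
    rw [← map_pow, toAlgebra_mulLeft, AddEquiv.apply_symm_apply, mul_one]
  rw [← hT1, norm_toAlgebra]
  exact (ContinuousLinearMap.le_opNorm _ _).trans (mul_le_mul_of_nonneg_right hm (norm_nonneg _))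

theorem summable_norm_pow_mul (φ : ContractiveRep A) {ρ : ℝ} (hρ : 0 < ρ)
    (hT : ∀ z ∉ Metric.ball (0 : ℂ) ρ, IsUnit (quadratic T z)) {c : ℕ → A}
    (hc : Summable fun m => ρ ^ m * ‖c m‖) : Summable fun m => ‖T ^ m * c m‖ := by
  refine (hc.mul_left ‖(1 : A)‖).of_norm_bounded_eventually_nat ?_
  filter_upwards [φ.eventually_norm_pow_le hρ hT] with m hm
  rw [norm_norm, ← mul_assoc, mul_comm ‖(1 : A)‖]
  exact (norm_mul_le _ _).trans (mul_le_mul_of_nonneg_right hm (norm_nonneg _))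

/-- The operator-valued differential `S⁻¹(z, T) dz` along a curve. -/
def cauchyKernel (T : A) (γ : ℝ → ℂ) (t : ℝ) : A := φ.sResolvent T (γ t) * φ.hom (deriv γ t)

theorem intervalIntegrable_cauchyKernel {γ : ℝ → ℂ} (hγ : IsClosedPiecewiseC1 γ)
    (hT : ∀ z ∈ γ '' Icc 0 1, IsUnit (quadratic T z)) :
    IntervalIntegrable (φ.cauchyKernel T γ) volume 0 1 := by
  have hres : ContinuousOn (fun t => φ.sResolvent T (γ t)) (uIcc 0 1) := by
    rw [uIcc_of_le zero_le_one]
    exact (φ.continuousOn_sResolvent T).comp hγ.continuousOn fun t ht =>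
      hT _ (mem_image_of_mem γ ht)
  let L : ℂ →L[ℝ] A := ⟨φ.hom.toLinearMap, φ.continuous_hom⟩
  have hderiv : IntervalIntegrable (fun t => φ.hom (deriv γ t)) volume 0 1 :=
    ⟨L.integrable_comp hγ.intervalIntegrable_deriv.1,
      L.integrable_comp hγ.intervalIntegrable_deriv.2⟩
  exact hderiv.continuousOn_mul hres

theorem evalOne_contourIntegral_pow_smul_resolvent {γ : ℝ → ℂ} (hγ : IsClosedPiecewiseC1 γ)
    (hT : ∀ z ∈ γ '' Icc 0 1, IsUnit (quadratic T z)) (m : ℕ) :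
    φ.evalOne (contourIntegral γ fun z => z ^ m • resolvent (φ.mulLeft T) z)
      = ∫ t in (0 : ℝ)..1, φ.cauchyKernel T γ t * φ.hom (γ t) ^ m := by
  have hcont : ContinuousOn (fun z => z ^ m • resolvent (φ.mulLeft T) z) (γ '' Icc 0 1) :=
    (continuous_pow m).continuousOn.smul ((continuousOn_resolvent _).mono fun z hz =>
      (φ.resolvent_mulLeft (hT z hz)).1)
  rw [contourIntegral,
    ← φ.evalOne.intervalIntegral_comp_comm (hγ.intervalIntegrable_deriv_smul hcont)]
  refine intervalIntegral.integral_congr fun t ht => ?_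
  rw [uIcc_of_le zero_le_one] at ht
  simp only [evalOne_apply, smul_apply, toAlgebra_smul, cauchyKernel]
  rw [(φ.resolvent_mulLeft (hT _ (mem_image_of_mem γ ht))).2, mul_assoc, mul_assoc, ← map_pow,
    ← map_mul, ← map_mul, mul_comm (γ t ^ m)]

variable {ι : Type*} [Fintype ι] {γ : ι → ℝ → ℂ}

theorem sum_integral_cauchyKernel_mul_pow (h : IsCycleAround γ U)
    (hT : ∀ z ∉ U, IsUnit (quadratic T z)) (m : ℕ) :
    ∑ k, ∫ t in (0 : ℝ)..1, φ.cauchyKernel T (γ k) t * φ.hom (γ k t) ^ m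
      = T ^ m * φ.hom (2 * Real.pi * Complex.I) := by
  have hk : ∀ k, φ.evalOne (contourIntegral (γ k) fun z => z ^ m • resolvent (φ.mulLeft T) z)
      = ∫ t in (0 : ℝ)..1, φ.cauchyKernel T (γ k) t * φ.hom (γ k t) ^ m := fun k =>
    φ.evalOne_contourIntegral_pow_smul_resolvent (h.isClosedPiecewiseC1 k)
      (fun z hz => hT z (h.image_subset_compl k hz)) m
  rw [← Finset.sum_congr rfl fun k _ => hk k, ← map_sum,
    h.sum_contourIntegral_pow_smul_resolvent (φ.spectrum_mulLeft_subset hT), evalOne_apply,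
    smul_apply, toAlgebra_smul, ← map_pow, toAlgebra_mulLeft, AddEquiv.apply_symm_apply, mul_one]

theorem hasSum_sum_integral_cauchyKernel_mul (h : IsCycleAround γ U)
    (hT : ∀ z ∉ U, IsUnit (quadratic T z)) {ρ : ℝ}
    (hρ : ∀ k, γ k '' Icc 0 1 ⊆ Metric.closedBall 0 ρ) {c : ℕ → A}
    (hc : Summable fun m => ρ ^ m * ‖c m‖) {S : ℂ → A}
    (hS : ∀ z ∈ Metric.closedBall 0 ρ, HasSum (fun m => φ.hom z ^ m * c m) (S z)) :
    HasSum (fun m => T ^ m * φ.hom (2 * Real.pi * Complex.I) * c m)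
      (∑ k, ∫ t in (0 : ℝ)..1, φ.cauchyKernel T (γ k) t * S (γ k t)) := by
  have hk : ∀ k, HasSum
      (fun m => (∫ t in (0 : ℝ)..1, φ.cauchyKernel T (γ k) t * φ.hom (γ k t) ^ m) * c m)
      (∫ t in (0 : ℝ)..1, φ.cauchyKernel T (γ k) t * S (γ k t)) := by
    intro k
    have hmem : ∀ t ∈ uIcc (0 : ℝ) 1, γ k t ∈ Metric.closedBall 0 ρ := fun t ht =>
      hρ k (mem_image_of_mem _ (uIcc_of_le (zero_le_one (α := ℝ)) ▸ ht))
    have hcont := (h.isClosedPiecewiseC1 k).continuousOn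
    rw [← uIcc_of_le zero_le_one] at hcont
    exact hasSum_intervalIntegral_mul_pow_mul
      (φ.intervalIntegrable_cauchyKernel (h.isClosedPiecewiseC1 k) fun z hz =>
        hT z (h.image_subset_compl k hz))
      (φ.continuous_hom.comp_continuousOn hcont)
      (fun t ht => (φ.norm_le _).trans (mem_closedBall_zero_iff.1 (hmem t ht))) hc
      fun t ht => hS _ (hmem t ht)
  simpa only [← Finset.sum_mul, φ.sum_integral_cauchyKernel_mul_pow h hT] using
    hasSum_sum fun k (_ : k ∈ Finset.univ) => hk k

end ContractiveRep

/-! ### Slices of the quaternions -/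

section Slice

theorem imagSphere_nonempty : imagSphere.Nonempty := by
  refine ⟨Quaternion.ofComplex Complex.I, by simp, ?_⟩
  rw [← sq_eq_sq₀ (norm_nonneg _) zero_le_one, sq, ← Quaternion.normSq_eq_norm_mul_self,
    Quaternion.normSq_def']
  simp

theorem slice_ofReal (I : ℍ[ℝ]) (x : ℝ) : slice I x = x := by simp [slice]

variable {I : ℍ[ℝ]}

theorem mul_self_of_mem_imagSphere (hI : I ∈ imagSphere) : I * I = -1 := by
  rw [← sq, Quaternion.sq_eq_neg_normSq.2 hI.1, Quaternion.normSq_eq_norm_mul_self, hI.2]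
  simp

theorem re_slice (hI : I ∈ imagSphere) (z : ℂ) : (slice I z).re = z.re := by
  simp [slice, hI.1]

theorem star_slice (hI : I ∈ imagSphere) (z : ℂ) :
    star (slice I z) = slice I (starRingEnd ℂ z) := by
  ext <;> simp [slice, hI.1, mul_comm]

/-- The homomorphism `x + iy ↦ x + Iy` of real algebras. -/
def sliceHom (hI : I ∈ imagSphere) : ℂ →ₐ[ℝ] ℍ[ℝ] :=
  Complex.lift ⟨I, mul_self_of_mem_imagSphere hI⟩

theorem sliceHom_apply (hI : I ∈ imagSphere) (z : ℂ) : sliceHom hI z = slice I z := by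
  rw [sliceHom, Complex.lift_apply, Complex.liftAux_apply, slice, ← Quaternion.coe_mul_eq_smul,
    Quaternion.coe_commutes, Quaternion.algebraMap_def]

theorem norm_slice (hI : I ∈ imagSphere) (z : ℂ) : ‖slice I z‖ = ‖z‖ := by
  have h : ((Quaternion.normSq (slice I z) : ℝ) : ℍ[ℝ]) = (Complex.normSq z : ℝ) := by
    rw [← Quaternion.self_mul_star, star_slice hI, ← sliceHom_apply hI, ← sliceHom_apply hI,
      ← map_mul, Complex.mul_conj, sliceHom_apply, slice_ofReal]
  rw [Quaternion.coe_inj, Quaternion.normSq_eq_norm_mul_self, Complex.normSq_eq_norm_sq, ← sq] at h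
  exact (sq_eq_sq₀ (norm_nonneg _) (norm_nonneg _)).1 h

theorem slice_mem_ball_iff (hI : I ∈ imagSphere) {z : ℂ} {R : ℝ} :
    slice I z ∈ Metric.ball (0 : ℍ[ℝ]) R ↔ z ∈ Metric.ball (0 : ℂ) R := by
  rw [mem_ball_zero_iff, mem_ball_zero_iff, norm_slice hI]

theorem commute_slice (I : ℍ[ℝ]) (z : ℂ) : Commute I (slice I z) :=
  (Quaternion.coe_commute z.re I).symm.add_right
    ((Commute.refl I).mul_right (Quaternion.coe_commute z.im I).symm)

theorem exists_slice_eq (s : ℍ[ℝ]) : ∃ I ∈ imagSphere, ∃ z, slice I z = s := by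
  by_cases h : s.im = 0
  · obtain ⟨I, hI⟩ := imagSphere_nonempty
    refine ⟨I, hI, s.re, ?_⟩
    rw [slice_ofReal, ← Quaternion.re_add_im s, h]
    simp
  · have h0 : ‖s.im‖ ≠ 0 := norm_ne_zero_iff.2 h
    refine ⟨‖s.im‖⁻¹ • s.im, ⟨by simp, ?_⟩, ⟨s.re, ‖s.im‖⟩, ?_⟩
    · rw [norm_smul, norm_inv, norm_norm, inv_mul_cancel₀ h0]
    · rw [slice, ← Quaternion.coe_commutes, Quaternion.coe_mul_eq_smul, smul_smul,
        mul_inv_cancel₀ h0, one_smul, Quaternion.re_add_im]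

end Slice

/-! ### Slice regular functions -/

theorem leftRegularOn_iff {f : ℍ[ℝ] → ℍ[ℝ]} {Ω : Set ℍ[ℝ]} (hΩ : IsOpen Ω) :
    LeftRegularOn f Ω ↔ (∀ s ∈ Ω, DifferentiableAt ℝ f s) ∧
      ∀ I ∈ imagSphere, ∀ z, slice I z ∈ Ω →
        fderiv ℝ f (slice I z) 1 + I * fderiv ℝ f (slice I z) I = 0 := by
  have hcoe : ∀ x : ℝ, HasDerivAt (fun u : ℝ => (u : ℍ[ℝ])) 1 x := fun x =>
    ((Algebra.linearMap ℝ ℍ[ℝ]).toContinuousLinearMap.hasDerivAt (x := x)).congr_deriv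
      (by simp)
  have hx : ∀ (I : ℍ[ℝ]) (x y : ℝ), DifferentiableAt ℝ f (slice I ⟨x, y⟩) →
      deriv (fun u : ℝ => f ((u : ℍ[ℝ]) + I * (y : ℍ[ℝ]))) x = fderiv ℝ f (slice I ⟨x, y⟩) 1 :=
    fun I x y hd => (hd.hasFDerivAt.comp_hasDerivAt x ((hcoe x).add_const _)).deriv
  have hy : ∀ (I : ℍ[ℝ]) (x y : ℝ), DifferentiableAt ℝ f (slice I ⟨x, y⟩) →
      deriv (fun v : ℝ => f ((x : ℍ[ℝ]) + I * (v : ℍ[ℝ]))) y = fderiv ℝ f (slice I ⟨x, y⟩) I := by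
    intro I x y hd
    have := (hd.hasFDerivAt.comp_hasDerivAt y (((hcoe y).const_mul I).const_add (x : ℍ[ℝ]))).deriv
    rwa [mul_one] at this
  have hdiff : DifferentiableOn ℝ f Ω ↔ ∀ s ∈ Ω, DifferentiableAt ℝ f s :=
    forall₂_congr fun s hs => ⟨fun h => h.differentiableAt (hΩ.mem_nhds hs),
      fun h => h.differentiableWithinAt⟩
  rw [LeftRegularOn, hdiff]
  refine and_congr_right fun hd => ⟨fun h I hI z hz => ?_, fun h I hI x y hz => ?_⟩
  · have := h I hI z.re z.im hz
    rw [hx I z.re z.im (hd _ hz), hy I z.re z.im (hd _ hz)] at this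
    exact (smul_eq_zero.1 this).resolve_left (by norm_num)
  · rw [hx I x y (hd _ hz), hy I x y (hd _ hz)]
    exact smul_eq_zero_of_right _ (h I hI ⟨x, y⟩ hz)

/-- The quaternions as a complex Banach space, with `z` acting as left multiplication by
`slice I z`. It depends on `I`, hence is not an instance. -/
abbrev sliceNormedSpace {I : ℍ[ℝ]} (hI : I ∈ imagSphere) : NormedSpace ℂ ℍ[ℝ] where
  __ := Module.compHom ℍ[ℝ] (sliceHom hI).toRingHom
  norm_smul_le z q := by
    change ‖sliceHom hI z * q‖ ≤ _
    rw [norm_mul, sliceHom_apply, norm_slice hI]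

namespace LeftRegularOn

variable {f g : ℍ[ℝ] → ℍ[ℝ]} {Ω Ω' : Set ℍ[ℝ]}

theorem mono (hf : LeftRegularOn f Ω) (h : Ω' ⊆ Ω) : LeftRegularOn f Ω' :=
  ⟨hf.1.mono h, fun I hI x y hxy => hf.2 I hI x y (h hxy)⟩

theorem add (hΩ : IsOpen Ω) (hf : LeftRegularOn f Ω) (hg : LeftRegularOn g Ω) :
    LeftRegularOn (f + g) Ω := by
  rw [leftRegularOn_iff hΩ] at *
  refine ⟨fun s hs => (hf.1 s hs).add (hg.1 s hs), fun I hI z hz => ?_⟩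
  have hcr := congrArg₂ (· + ·) (hf.2 I hI z hz) (hg.2 I hI z hz)
  rw [add_zero, add_add_add_comm, ← mul_add] at hcr
  rwa [fderiv_add (hf.1 _ hz) (hg.1 _ hz)]

theorem mul (hΩ : IsOpen Ω) (hf : LeftRegularOn f Ω) (hg : LeftRegularOn g Ω)
    (hcomm : ∀ I ∈ imagSphere, ∀ z, slice I z ∈ Ω → Commute I (f (slice I z))) :
    LeftRegularOn (f * g) Ω := by
  rw [leftRegularOn_iff hΩ] at *
  refine ⟨fun s hs => (hf.1 s hs).mul (hg.1 s hs), fun I hI z hz => ?_⟩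
  rw [fderiv_mul' (hf.1 _ hz) (hg.1 _ hz)]
  calc _ = (fderiv ℝ f (slice I z) 1 + I * fderiv ℝ f (slice I z) I) * g (slice I z)
        + f (slice I z) * (fderiv ℝ g (slice I z) 1 + I * fderiv ℝ g (slice I z) I) := by
          simp only [add_apply, smul_apply, smul_eq_mul, MulOpposite.smul_eq_mul_unop,
            MulOpposite.unop_op, mul_add, add_mul, ← mul_assoc, (hcomm I hI z hz).eq]
          abel
    _ = 0 := by rw [hf.2 I hI z hz, hg.2 I hI z hz, zero_mul, mul_zero, add_zero]

theorem mul_const (hΩ : IsOpen Ω) (hf : LeftRegularOn f Ω) (c : ℍ[ℝ]) :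
    LeftRegularOn (fun s => f s * c) Ω := by
  rw [leftRegularOn_iff hΩ] at *
  refine ⟨fun s hs => (hf.1 s hs).mul_const c, fun I hI z hz => ?_⟩
  rw [fderiv_mul_const' (hf.1 _ hz)]
  simpa [add_mul, mul_assoc] using congrArg (· * c) (hf.2 I hI z hz)

variable {I : ℍ[ℝ]}

theorem fderiv_slice (hΩ : IsOpen Ω) (hf : LeftRegularOn f Ω) (hI : I ∈ imagSphere) {z : ℂ}
    (hz : slice I z ∈ Ω) (w : ℂ) :
    fderiv ℝ f (slice I z) (slice I w) = slice I w * fderiv ℝ f (slice I z) 1 := by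
  have hcr := congrArg (I * ·) (((leftRegularOn_iff hΩ).1 hf).2 I hI z hz)
  simp only [mul_add, mul_zero, ← mul_assoc, mul_self_of_mem_imagSphere hI, neg_mul, one_mul,
    ← sub_eq_add_neg, sub_eq_zero] at hcr
  have hw : slice I w = w.re • (1 : ℍ[ℝ]) + w.im • I := by
    rw [slice, ← Quaternion.coe_commutes, Quaternion.coe_mul_eq_smul,
      ← Algebra.algebraMap_eq_smul_one, Quaternion.algebraMap_def]
  rw [hw, map_add, map_smul, map_smul, ← hcr, add_mul, smul_mul_assoc, smul_mul_assoc, one_mul]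

theorem hasDerivAt_comp_slice (hΩ : IsOpen Ω) (hf : LeftRegularOn f Ω) (hI : I ∈ imagSphere)
    {z : ℂ} (hz : slice I z ∈ Ω) :
    letI := sliceNormedSpace hI
    HasDerivAt (fun w => f (slice I w)) (fderiv ℝ f (slice I z) 1) z := by
  let _ := sliceNormedSpace hI
  let L : ℂ →L[ℝ] ℍ[ℝ] := (sliceHom hI).toLinearMap.toContinuousLinearMap
  have hL : ∀ w, L w = slice I w := sliceHom_apply hI
  have hfderiv : HasFDerivAt (f ∘ L) ((fderiv ℝ f (slice I z)).comp L) z := by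
    refine HasFDerivAt.comp z ?_ L.hasFDerivAt
    rw [hL]
    exact (((leftRegularOn_iff hΩ).1 hf).1 _ hz).hasFDerivAt
  rw [hasFDerivAt_iff_isLittleO] at hfderiv
  rw [hasDerivAt_iff_isLittleO]
  refine hfderiv.congr_left fun w => ?_
  simp only [Function.comp_apply, ContinuousLinearMap.comp_apply, hL]
  rw [hf.fderiv_slice hΩ hI hz, ← sliceHom_apply hI (w - z)]
  rfl

theorem exists_hasSum_slice {R : ℝ} (hf : LeftRegularOn f (Metric.ball 0 R))
    (hI : I ∈ imagSphere) : ∃ a : ℕ → ℍ[ℝ], ∀ z ∈ Metric.ball (0 : ℂ) R,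
      HasSum (fun n => slice I z ^ n * a n) (f (slice I z)) := by
  let _ := sliceNormedSpace hI
  have hd : DifferentiableOn ℂ (fun z => f (slice I z)) (Metric.ball 0 R) := fun z hz =>
    (hf.hasDerivAt_comp_slice Metric.isOpen_ball hI
      ((slice_mem_ball_iff hI).2 hz)).differentiableAt.differentiableWithinAt
  refine ⟨fun n => (n.factorial : ℂ)⁻¹ • iteratedDeriv n (fun z => f (slice I z)) 0,
    fun z hz => ?_⟩
  refine (Complex.hasSum_taylorSeries_on_ball hd hz).congr_fun fun n => ?_
  rw [smul_comm, sub_zero, ← sliceHom_apply hI, ← map_pow]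
  rfl

end LeftRegularOn

/-! ### Power series with quaternionic coefficients -/

theorem eq_of_hasSum_pow_smul {𝕜 E : Type*} [NontriviallyNormedField 𝕜] [NormedAddCommGroup E]
    [NormedSpace 𝕜 E] {a b : ℕ → E} {g : 𝕜 → E}
    (ha : ∀ᶠ x in 𝓝 0, HasSum (fun n => x ^ n • a n) (g x))
    (hb : ∀ᶠ x in 𝓝 0, HasSum (fun n => x ^ n • b n) (g x)) : a = b := by
  let p : (ℕ → E) → FormalMultilinearSeries 𝕜 𝕜 E := fun c n =>
    ContinuousMultilinearMap.mkPiRing 𝕜 (Fin n) (c n)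
  have hcoeff : ∀ c n, (p c).coeff n = c n := fun c n => by
    simp [p, FormalMultilinearSeries.coeff]
  have hseries : ∀ c : ℕ → E, (∀ᶠ x in 𝓝 0, HasSum (fun n => x ^ n • c n) (g x)) →
      HasFPowerSeriesAt g (p c) 0 := fun c hc =>
    hasFPowerSeriesAt_iff.2 (by simpa only [hcoeff, zero_add] using hc)
  have hab := (hseries a ha).eq_formalMultilinearSeries (hseries b hb)
  funext n
  rw [← hcoeff a, ← hcoeff b, hab]

theorem eq_of_hasSum_coe_pow_mul {a b : ℕ → ℍ[ℝ]} {f : ℍ[ℝ] → ℍ[ℝ]} {R R' : ℝ} (hR : 0 < R)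
    (hR' : 0 < R') (ha : ∀ x : ℝ, |x| < R → HasSum (fun n => (x : ℍ[ℝ]) ^ n * a n) (f x))
    (hb : ∀ x : ℝ, |x| < R' → HasSum (fun n => (x : ℍ[ℝ]) ^ n * b n) (f x)) : a = b := by
  have hev : ∀ {r : ℝ}, 0 < r → ∀ᶠ x : ℝ in 𝓝 0, |x| < r := fun hr =>
    (continuous_abs.tendsto' 0 0 abs_zero).eventually_lt_const hr
  simp only [← Quaternion.coe_pow, Quaternion.coe_mul_eq_smul] at ha hb
  exact eq_of_hasSum_pow_smul ((hev hR).mono ha) ((hev hR').mono hb)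

theorem hasSum_pow_mul_sum_antidiagonal {A : Type*} [NormedRing A] [NormedAlgebra ℝ A]
    [CompleteSpace A] {T X Y : A} {a : ℕ → ℝ} {b : ℕ → A}
    (ha : Summable fun n => ‖T ^ n * algebraMap ℝ A (a n)‖)
    (hb : Summable fun n => ‖T ^ n * b n‖)
    (hX : HasSum (fun n => T ^ n * algebraMap ℝ A (a n)) X)
    (hY : HasSum (fun n => T ^ n * b n) Y) :
    HasSum (fun n => T ^ n * ∑ p ∈ Finset.HasAntidiagonal.antidiagonal n, a p.1 • b p.2)
      (X * Y) := by
  have hprod := (summable_norm_sum_mul_antidiagonal_of_summable_norm ha hb).of_norm.hasSum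
  rw [← tsum_mul_tsum_eq_tsum_sum_antidiagonal_of_summable_norm ha hb, hX.tsum_eq,
    hY.tsum_eq] at hprod
  refine hprod.congr_fun fun n => ?_
  rw [Finset.mul_sum]
  refine Finset.sum_congr rfl fun p hp => ?_
  rw [← Finset.HasAntidiagonal.mem_antidiagonal.1 hp, pow_add, ← Algebra.commutes,
    ← Algebra.smul_def, smul_mul_assoc, mul_smul_comm, mul_assoc]

/-- `f(s) = ∑ sⁿ aₙ` on the ball `B(0, R)`. -/
def HasRegularSeries (f : ℍ[ℝ] → ℍ[ℝ]) (a : ℕ → ℍ[ℝ]) (R : ℝ) : Prop :=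
  ∀ s ∈ Metric.ball (0 : ℍ[ℝ]) R, HasSum (fun n => s ^ n * a n) (f s)

theorem LeftRegularOn.exists_hasRegularSeries {f : ℍ[ℝ] → ℍ[ℝ]} {R : ℝ} (hR : 0 < R)
    (hf : LeftRegularOn f (Metric.ball 0 R)) : ∃ a, HasRegularSeries f a R := by
  obtain ⟨I₀, hI₀⟩ := imagSphere_nonempty
  obtain ⟨a, ha⟩ := hf.exists_hasSum_slice hI₀
  refine ⟨a, fun s hs => ?_⟩
  obtain ⟨I, hI, z, rfl⟩ := exists_slice_eq s
  obtain ⟨b, hb⟩ := hf.exists_hasSum_slice hI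
  have hab : a = b := eq_of_hasSum_coe_pow_mul (f := f) hR hR
    (fun x hx => by simpa only [slice_ofReal] using ha x (by simpa using hx))
    (fun x hx => by simpa only [slice_ofReal] using hb x (by simpa using hx))
  exact hab ▸ hb z ((slice_mem_ball_iff hI).1 hs)

namespace HasRegularSeries

variable {f g : ℍ[ℝ] → ℍ[ℝ]} {a b : ℕ → ℍ[ℝ]} {R R' : ℝ}

theorem mono (h : HasRegularSeries f a R) (hR : R' ≤ R) : HasRegularSeries f a R' :=
  fun s hs => h s (Metric.ball_subset_ball hR hs)

theorem unique (ha : HasRegularSeries f a R) (hb : HasRegularSeries f b R') (hR : 0 < R)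
    (hR' : 0 < R') : a = b :=
  eq_of_hasSum_coe_pow_mul hR hR' (fun x hx => ha x (by simpa using hx))
    fun x hx => hb x (by simpa using hx)

theorem summable_norm (ha : HasRegularSeries f a R) {ρ : ℝ} (h0 : 0 ≤ ρ) (hρ : ρ < R) :
    Summable fun n => ρ ^ n * ‖a n‖ := by
  obtain ⟨r, hr, hrR⟩ := exists_between hρ
  have hr0 : 0 < r := h0.trans_lt hr
  have hsum := (ha r (by simpa [abs_of_pos hr0] using hrR)).summable
  simp only [← Quaternion.coe_pow, Quaternion.coe_commutes] at hsum
  simp only [Quaternion.coe_pow] at hsum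
  have hlt : ‖(ρ : ℍ[ℝ])‖ < ‖(r : ℍ[ℝ])‖ := by simpa [abs_of_pos hr0, abs_of_nonneg h0] using hr
  simpa [abs_of_nonneg h0, mul_comm] using
    (summable_powerSeries_of_norm_lt hsum.hasSum.tendsto_sum_nat.cauchySeq hlt).norm

theorem add (ha : HasRegularSeries f a R) (hb : HasRegularSeries g b R) :
    HasRegularSeries (f + g) (a + b) R := fun s hs => by
  simpa [mul_add] using (ha s hs).add (hb s hs)

theorem mul_const (ha : HasRegularSeries f a R) (c : ℍ[ℝ]) :
    HasRegularSeries (fun s => f s * c) (fun n => a n * c) R := fun s hs => by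
  simpa [mul_assoc] using (ha s hs).mul_right c

variable {r : ℕ → ℝ}

theorem real_mul (ha : HasRegularSeries f (fun n => (r n : ℍ[ℝ])) R)
    (hb : HasRegularSeries g b R) :
    HasRegularSeries (f * g)
      (fun n => ∑ p ∈ Finset.HasAntidiagonal.antidiagonal n, r p.1 • b p.2) R := by
  intro s hs
  have hsR := mem_ball_zero_iff.1 hs
  refine hasSum_pow_mul_sum_antidiagonal ?_ ?_ (ha s hs) (hb s hs)
  · simpa only [norm_mul, norm_pow, Quaternion.algebraMap_def] using
      ha.summable_norm (norm_nonneg s) hsR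
  · simpa only [norm_mul, norm_pow] using hb.summable_norm (norm_nonneg s) hsR

theorem commute_slice (ha : HasRegularSeries f (fun n => (r n : ℍ[ℝ])) R) {I : ℍ[ℝ]} {z : ℂ}
    (hz : slice I z ∈ Metric.ball 0 R) : Commute I (f (slice I z)) := by
  refine ((ha _ hz).mul_left I).unique (((ha _ hz).mul_right I).congr_fun fun n => ?_)
  exact ((QuaternionicCalculus.commute_slice I z).pow_right n).mul_right
    (Quaternion.coe_commute (r n) I).symm

end HasRegularSeries

/-! ### Disks as slice domains -/

theorem IsClosedPiecewiseC1.of_contDiff {γ : ℝ → ℂ} (h : γ 0 = γ 1) (hγ : ContDiff ℝ 1 γ) :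
    IsClosedPiecewiseC1 γ := by
  refine ⟨h, 1, ![0, 1], fun i j hij => ?_, rfl, rfl, fun _ => hγ.contDiffOn⟩
  fin_cases i <;> fin_cases j <;> simp_all

/-- The counterclockwise circle around `0`, parametrized by `[0, 1]`. -/
def circleCurve (ρ t : ℝ) : ℂ := circleMap 0 ρ (2 * Real.pi * t)

theorem isClosedPiecewiseC1_circleCurve (ρ : ℝ) : IsClosedPiecewiseC1 (circleCurve ρ) :=
  .of_contDiff (by simp [circleCurve, circleMap])
    ((contDiff_circleMap 0 ρ).comp (contDiff_const.mul contDiff_id))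

theorem image_circleCurve (ρ : ℝ) : circleCurve ρ '' Icc 0 1 = Metric.sphere 0 |ρ| := by
  have himage : (2 * Real.pi * ·) '' Icc 0 1 = Icc 0 (2 * Real.pi) := by
    rw [image_mul_left_Icc Real.two_pi_pos.le zero_le_one, mul_zero, mul_one]
  calc circleCurve ρ '' Icc 0 1 = circleMap 0 ρ '' Icc 0 (2 * Real.pi) := by
        rw [← himage, image_image]; rfl
    _ = Metric.sphere 0 |ρ| := by
      refine Subset.antisymm ?_ (image_circleMap_Ioc 0 ρ ▸ image_mono Ioc_subset_Icc_self)
      rw [← range_circleMap]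
      exact image_subset_range _ _

theorem windingNumber_circleCurve (ρ : ℝ) (w : ℂ) :
    windingNumber (circleCurve ρ) w
      = (2 * Real.pi * Complex.I)⁻¹ * ∮ z in C(0, ρ), (z - w)⁻¹ := by
  have hderiv : ∀ t, deriv (circleCurve ρ) t
      = (2 * Real.pi) • deriv (circleMap 0 ρ) (2 * Real.pi * t) :=
    deriv_comp_mul_left (2 * Real.pi) (circleMap 0 ρ)
  have hsubst := intervalIntegral.smul_integral_comp_mul_left (a := 0) (b := 1)
    (fun θ => deriv (circleMap 0 ρ) θ • (circleMap 0 ρ θ - w)⁻¹) (2 * Real.pi)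
  rw [mul_zero, mul_one] at hsubst
  rw [windingNumber, circleIntegral, ← hsubst, ← intervalIntegral.integral_smul]
  congr 1
  refine intervalIntegral.integral_congr fun t _ => ?_
  rw [hderiv, div_eq_mul_inv, smul_mul_assoc]
  rfl

theorem windingNumber_circleCurve_of_mem_ball {ρ : ℝ} {w : ℂ} (hw : w ∈ Metric.ball 0 ρ) :
    windingNumber (circleCurve ρ) w = 1 := by
  rw [windingNumber_circleCurve, circleIntegral.integral_sub_inv_of_mem_ball hw,
    inv_mul_cancel₀ Complex.two_pi_I_ne_zero]

theorem windingNumber_circleCurve_of_notMem_closedBall {ρ : ℝ} (hρ : 0 ≤ ρ) {w : ℂ}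
    (hw : w ∉ Metric.closedBall 0 ρ) : windingNumber (circleCurve ρ) w = 0 := by
  have hcont : DifferentiableOn ℂ (fun z => (z - w)⁻¹) (Metric.closedBall 0 ρ) := fun z hz =>
    ((differentiableAt_id.sub_const w).inv
      (sub_ne_zero.2 (ne_of_mem_of_not_mem hz hw))).differentiableWithinAt
  rw [windingNumber_circleCurve, (hcont.mono Metric.closure_ball_subset_closedBall
    |>.diffContOnCl).circleIntegral_eq_zero hρ, mul_zero]

/-- The disk of radius `ρ` around `0` in the slice `L_I`. -/
def diskDomain {I : ℍ[ℝ]} (hI : I ∈ imagSphere) {ρ : ℝ} (hρ : 0 < ρ) : SliceDomain where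
  I := I
  I_mem := hI
  U := Metric.ball 0 ρ
  isOpen := Metric.isOpen_ball
  isBounded := Metric.isBounded_ball
  n := 1
  γ := fun _ => circleCurve ρ
  closed_curve := fun _ => isClosedPiecewiseC1_circleCurve ρ
  image_eq := by
    rw [iUnion_const, image_circleCurve, abs_of_pos hρ, frontier_ball _ hρ.ne']
  winding_inside := fun w hw => by
    rw [Fin.sum_univ_one, windingNumber_circleCurve_of_mem_ball hw]
  winding_outside := fun w hw => by
    rw [closure_ball _ hρ.ne'] at hw
    rw [Fin.sum_univ_one, windingNumber_circleCurve_of_notMem_closedBall hρ.le hw]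

/-! ### The functional calculus -/

section Operators

variable {V : Type*} [NormedAddCommGroup V] [NormedSpace ℝ V]
  [Module ℍ[ℝ]ᵐᵒᵖ V] [IsScalarTower ℝ ℍ[ℝ]ᵐᵒᵖ V]
  {T : BoundedOp V} {I : ℍ[ℝ]} {f g : ℍ[ℝ] → ℍ[ℝ]} {a b : ℕ → ℍ[ℝ]} {r : ℕ → ℝ}

theorem boundedOp_ext {S T : BoundedOp V} (h : ∀ v, S.1 v = T.1 v) : S = T :=
  Subtype.ext (ContinuousLinearMap.ext h)

theorem quadratic_eq_sPolynomial (hI : I ∈ imagSphere) (T : BoundedOp V) (z : ℂ) :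
    ContractiveRep.quadratic T z = sPolynomial (slice I z) T := by
  rw [ContractiveRep.quadratic, sPolynomial, re_slice hI, norm_slice hI]

theorem isUnit_quadratic_iff (hI : I ∈ imagSphere) {z : ℂ} :
    IsUnit (ContractiveRep.quadratic T z) ↔ slice I z ∉ sSpectrum T := by
  rw [quadratic_eq_sPolynomial hI, sSpectrum, mem_ofPred_eq, not_not]

theorem SliceDomain.isCycleAround (D : SliceDomain) : IsCycleAround D.γ D.U where
  isClosedPiecewiseC1 := D.closed_curve
  isOpen := D.isOpen
  isBounded := D.isBounded
  image_subset_compl k := (subset_iUnion (fun k => D.γ k '' Icc 0 1) k).trans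
    (D.image_eq ▸ D.isOpen.frontier_eq ▸ sdiff_subset_compl _ _)
  sum_windingNumber := D.winding_inside

/-- `f` is regular on a ball around `0` that contains `σ_S(T)`, with power series `∑ sⁿ aₙ`. -/
def IsRegularSeriesNear (T : BoundedOp V) (f : ℍ[ℝ] → ℍ[ℝ]) (a : ℕ → ℍ[ℝ]) : Prop :=
  ∃ R : ℝ, 0 < R ∧ sSpectrum T ⊆ Metric.ball 0 R ∧ LeftRegularOn f (Metric.ball 0 R) ∧
    HasRegularSeries f a R

theorem exists_isRegularSeriesNear (hf : f ∈ locallyRegular T) :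
    ∃ a, IsRegularSeriesNear T f a := by
  obtain ⟨R, hR, hT, hfR⟩ := hf
  obtain ⟨a, ha⟩ := hfR.exists_hasRegularSeries hR
  exact ⟨a, R, hR, hT, hfR, ha⟩

theorem IsRealPowerSeriesNear.exists_isRegularSeriesNear (hs : IsRealPowerSeriesNear T f)
    (hf : f ∈ locallyRegular T) : ∃ r : ℕ → ℝ, IsRegularSeriesNear T f fun n => (r n : ℍ[ℝ]) := by
  obtain ⟨a, R, hR, hT, hfR, ha⟩ := QuaternionicCalculus.exists_isRegularSeriesNear hf
  obtain ⟨r, R', hR', -, hr⟩ := hs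
  exact ⟨r, R, hR, hT, hfR, ha.unique hr hR hR' ▸ ha⟩

namespace IsRegularSeriesNear

theorem mem_locallyRegular (hf : IsRegularSeriesNear T f a) : f ∈ locallyRegular T :=
  let ⟨R, hR, hT, hfR, _⟩ := hf
  ⟨R, hR, hT, hfR⟩

theorem exists_common_radius (hf : IsRegularSeriesNear T f a) (hg : IsRegularSeriesNear T g b) :
    ∃ R : ℝ, 0 < R ∧ sSpectrum T ⊆ Metric.ball 0 R ∧
      (LeftRegularOn f (Metric.ball 0 R) ∧ HasRegularSeries f a R) ∧
      LeftRegularOn g (Metric.ball 0 R) ∧ HasRegularSeries g b R := by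
  obtain ⟨R₁, hR₁, hT₁, hf, ha⟩ := hf
  obtain ⟨R₂, hR₂, hT₂, hg, hb⟩ := hg
  have hle₁ := min_le_left R₁ R₂
  have hle₂ := min_le_right R₁ R₂
  refine ⟨min R₁ R₂, lt_min hR₁ hR₂, fun s hs => ?_,
    ⟨hf.mono (Metric.ball_subset_ball hle₁), ha.mono hle₁⟩,
    hg.mono (Metric.ball_subset_ball hle₂), hb.mono hle₂⟩
  exact Metric.mem_ball.2 (lt_min (Metric.mem_ball.1 (hT₁ hs)) (Metric.mem_ball.1 (hT₂ hs)))

theorem add (hf : IsRegularSeriesNear T f a) (hg : IsRegularSeriesNear T g b) :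
    IsRegularSeriesNear T (f + g) (a + b) :=
  let ⟨R, hR, hT, ⟨hf, ha⟩, hg, hb⟩ := hf.exists_common_radius hg
  ⟨R, hR, hT, hf.add Metric.isOpen_ball hg, ha.add hb⟩

theorem mul_const (hf : IsRegularSeriesNear T f a) (c : ℍ[ℝ]) :
    IsRegularSeriesNear T (fun s => f s * c) fun n => a n * c :=
  let ⟨R, hR, hT, hf, ha⟩ := hf
  ⟨R, hR, hT, hf.mul_const Metric.isOpen_ball c, ha.mul_const c⟩

theorem real_mul (hf : IsRegularSeriesNear T f fun n => (r n : ℍ[ℝ]))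
    (hg : IsRegularSeriesNear T g b) :
    IsRegularSeriesNear T (f * g)
      fun n => ∑ p ∈ Finset.HasAntidiagonal.antidiagonal n, r p.1 • b p.2 :=
  let ⟨R, hR, hT, ⟨hf, ha⟩, hg, hb⟩ := hf.exists_common_radius hg
  ⟨R, hR, hT, hf.mul Metric.isOpen_ball hg fun _ _ _ hz => ha.commute_slice hz, ha.real_mul hb⟩

end IsRegularSeriesNear

section Complete

variable [IsBoundedSMul ℍ[ℝ]ᵐᵒᵖ V] [CompleteSpace V]

theorem isClosed_sSpectrum (T : BoundedOp V) : IsClosed (sSpectrum T) := by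
  have hcont : Continuous fun s : ℍ[ℝ] => sPolynomial s T := by
    have := Quaternion.continuous_re
    unfold sPolynomial
    fun_prop
  exact (Units.isOpen.preimage hcont).isClosed_compl

theorem exists_admissible (hf : f ∈ locallyRegular T) : ∃ D : SliceDomain, D.Admissible T f := by
  obtain ⟨R, hR, hT, hfR⟩ := hf
  obtain ⟨ρ, ⟨hρ, hρR⟩, hTρ⟩ := exists_pos_lt_subset_ball hR (isClosed_sSpectrum T) hT
  obtain ⟨I, hI⟩ := imagSphere_nonempty
  refine ⟨diskDomain hI hρ, fun z hz => (slice_mem_ball_iff hI).1 (hTρ hz), R, hR, hT, hfR,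
    fun z hz => (slice_mem_ball_iff hI).2 ?_⟩
  exact Metric.closedBall_subset_ball hρR (Metric.closure_ball_subset_closedBall hz)

end Complete

variable [Module ℍ[ℝ] V] [IsBoundedSMul ℍ[ℝ] V] [IsScalarTower ℝ ℍ[ℝ] V]
  [SMulCommClass ℍ[ℝ] ℍ[ℝ]ᵐᵒᵖ V]

variable (V) in
/-- `a ↦ a 𝓘` as a homomorphism of real algebras. -/
def leftMulHom : ℍ[ℝ] →ₐ[ℝ] BoundedOp V where
  toFun := leftMul
  map_one' := boundedOp_ext fun v => one_smul _ v
  map_mul' a b := boundedOp_ext fun v => mul_smul a b v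
  map_zero' := boundedOp_ext fun v => zero_smul _ v
  map_add' a b := boundedOp_ext fun v => add_smul a b v
  commutes' r := boundedOp_ext fun v => algebraMap_smul ℍ[ℝ] r v

theorem leftMulHom_apply (a : ℍ[ℝ]) : leftMulHom V a = leftMul a := rfl

theorem leftMul_mul (a b : ℍ[ℝ]) : (leftMul (a * b) : BoundedOp V) = leftMul a * leftMul b :=
  map_mul (leftMulHom V) a b

theorem norm_leftMul_le (a : ℍ[ℝ]) : ‖(leftMul a : BoundedOp V)‖ ≤ ‖a‖ :=
  ContinuousLinearMap.opNorm_le_bound _ (norm_nonneg a) fun v => norm_smul_le a v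

variable (V) in
/-- The representation `x + iy ↦ (x + Iy) 𝓘` of `ℂ` that is defined by an imaginary unit. -/
def sliceRep (hI : I ∈ imagSphere) : ContractiveRep (BoundedOp V) where
  hom := (leftMulHom V).comp (sliceHom hI)
  norm_le z := by
    rw [AlgHom.comp_apply, leftMulHom_apply, sliceHom_apply, ← norm_slice hI z]
    exact norm_leftMul_le _

theorem sliceRep_hom (hI : I ∈ imagSphere) (z : ℂ) :
    (sliceRep V hI).hom z = leftMul (slice I z) :=
  congrArg leftMul (sliceHom_apply hI z)

theorem sliceRep_sResolvent (hI : I ∈ imagSphere) (T : BoundedOp V) (z : ℂ) :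
    (sliceRep V hI).sResolvent T z = sResolvent (slice I z) T := by
  rw [ContractiveRep.sResolvent, sResolvent, quadratic_eq_sPolynomial hI, sliceRep_hom,
    star_slice hI]

theorem sliceRep_hom_two_pi_I_mul (hI : I ∈ imagSphere) :
    (sliceRep V hI).hom (2 * Real.pi * Complex.I) * leftMul (-I)
      = algebraMap ℝ (BoundedOp V) (2 * Real.pi) := by
  have hslice : slice I (2 * Real.pi * Complex.I) * -I = algebraMap ℝ ℍ[ℝ] (2 * Real.pi) := by
    have hre : (2 * Real.pi * Complex.I : ℂ).re = 0 := by simp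
    have him : (2 * Real.pi * Complex.I : ℂ).im = 2 * Real.pi := by simp
    rw [slice, hre, him, Quaternion.coe_zero, zero_add, ← Quaternion.coe_commutes, mul_assoc,
      mul_neg, mul_self_of_mem_imagSphere hI, neg_neg, mul_one, Quaternion.algebraMap_def]
  rw [sliceRep_hom, ← leftMulHom_apply, ← leftMulHom_apply, ← map_mul, hslice, AlgHom.commutes]

theorem SliceDomain.cauchyIntegral_eq_sum_cauchyKernel (D : SliceDomain) (T : BoundedOp V)
    (f : ℍ[ℝ] → ℍ[ℝ]) :
    D.cauchyIntegral T f = (1 / (2 * Real.pi)) • ∑ k, ∫ t in (0 : ℝ)..1,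
      (sliceRep V D.I_mem).cauchyKernel T (D.γ k) t *
        leftMul (-D.I * f (slice D.I (D.γ k t))) := by
  rw [cauchyIntegral]
  refine congrArg _ (Finset.sum_congr rfl fun k _ => congrArg (intervalIntegral · 0 1 volume) ?_)
  funext t
  have hcomm := (commute_slice D.I (deriv (D.γ k) t)).neg_left.eq
  simp only [ContractiveRep.cauchyKernel, sliceRep_sResolvent, sliceRep_hom, ← leftMulHom_apply,
    hcomm, map_mul, mul_assoc]

theorem HasRegularSeries.summable_norm_leftMul {R ρ : ℝ} (ha : HasRegularSeries f a R) (h0 : 0 ≤ ρ)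
    (hρ : ρ < R) (q : ℍ[ℝ]) :
    Summable fun m => ρ ^ m * ‖(leftMul (q * a m) : BoundedOp V)‖ := by
  refine ((ha.summable_norm h0 hρ).mul_left ‖q‖).of_nonneg_of_le (fun m => by positivity)
    fun m => ?_
  rw [mul_left_comm, ← norm_mul]
  gcongr
  exact norm_leftMul_le _

theorem HasRegularSeries.hasSum_sliceRep_pow_mul {R : ℝ} (ha : HasRegularSeries f a R)
    (hI : I ∈ imagSphere) {z : ℂ} (hz : slice I z ∈ Metric.ball 0 R) :
    HasSum (fun m => (sliceRep V hI).hom z ^ m * leftMul (-I * a m))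
      (leftMul (-I * f (slice I z))) := by
  refine (((ha _ hz).mul_left (-I)).mapL
    (leftMulHom V).toLinearMap.toContinuousLinearMap).congr_fun fun m => ?_
  change _ = leftMulHom V (-I * (slice I z ^ m * a m))
  rw [sliceRep_hom, ← leftMulHom_apply, ← leftMulHom_apply, ← map_pow, ← map_mul, ← mul_assoc,
    ← mul_assoc, ((QuaternionicCalculus.commute_slice I z).neg_left.pow_right m).eq]

variable [IsBoundedSMul ℍ[ℝ]ᵐᵒᵖ V] [CompleteSpace V]

theorem IsRegularSeriesNear.summable_norm (hf : IsRegularSeriesNear T f a) :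
    Summable fun m => ‖T ^ m * leftMul (a m)‖ := by
  obtain ⟨R, hR, hT, -, ha⟩ := hf
  obtain ⟨ρ, ⟨hρ, hρR⟩, hTρ⟩ := exists_pos_lt_subset_ball hR (isClosed_sSpectrum T) hT
  obtain ⟨I, hI⟩ := imagSphere_nonempty
  refine (sliceRep V hI).summable_norm_pow_mul hρ (fun z hz => ?_)
    (by simpa only [one_mul] using ha.summable_norm_leftMul hρ.le hρR 1)
  exact (isUnit_quadratic_iff hI).2 fun hs => hz ((slice_mem_ball_iff hI).1 (hTρ hs))

theorem SliceDomain.Admissible.hasSum_cauchyIntegral {D : SliceDomain} (hD : D.Admissible T f)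
    (hf : IsRegularSeriesNear T f a) :
    HasSum (fun m => T ^ m * leftMul (a m)) (D.cauchyIntegral T f) := by
  obtain ⟨hU, R, hR, -, hfR, hDR⟩ := hD
  obtain ⟨R', hR', -, -, ha'⟩ := hf
  obtain ⟨a', ha⟩ := hfR.exists_hasRegularSeries hR
  obtain rfl := ha'.unique ha hR' hR
  obtain ⟨ρ, ⟨hρ, hρR⟩, hUρ⟩ := exists_pos_lt_subset_ball hR (isClosed_closure (s := D.U))
    fun z hz => (slice_mem_ball_iff D.I_mem).1 (hDR z hz)
  have hγ : ∀ k, D.γ k '' Icc 0 1 ⊆ Metric.closedBall 0 ρ := fun k =>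
    (subset_iUnion (fun k => D.γ k '' Icc 0 1) k).trans
      (D.image_eq ▸ frontier_subset_closure.trans (hUρ.trans Metric.ball_subset_closedBall))
  have hunit : ∀ z ∉ D.U, IsUnit (ContractiveRep.quadratic T z) := fun z hz =>
    (isUnit_quadratic_iff D.I_mem).2 fun hs => hz (hU z hs)
  have hS := fun (z : ℂ) (hz : z ∈ Metric.closedBall 0 ρ) => ha.hasSum_sliceRep_pow_mul (V := V)
    D.I_mem ((slice_mem_ball_iff D.I_mem).2 (Metric.closedBall_subset_ball hρR hz))
  rw [D.cauchyIntegral_eq_sum_cauchyKernel]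
  refine (((sliceRep V D.I_mem).hasSum_sum_integral_cauchyKernel_mul D.isCycleAround hunit hγ
    (ha.summable_norm_leftMul hρ.le hρR (-D.I)) hS).const_smul (1 / (2 * Real.pi))).congr_fun
    fun m => ?_
  rw [leftMul_mul, mul_assoc (T ^ m), ← mul_assoc _ (leftMul (-D.I)), sliceRep_hom_two_pi_I_mul,
    ← Algebra.smul_def, mul_smul_comm, smul_smul, one_div_mul_cancel Real.two_pi_pos.ne', one_smul]

theorem IsRegularSeriesNear.hasSum_funCalc (hf : IsRegularSeriesNear T f a) :
    HasSum (fun m => T ^ m * leftMul (a m)) (funCalc T f) := by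
  have hex := exists_admissible hf.mem_locallyRegular
  rw [funCalc, dif_pos hex]
  exact hex.choose_spec.hasSum_cauchyIntegral hf

theorem SliceDomain.Admissible.cauchyIntegral_eq_funCalc {D : SliceDomain}
    (hD : D.Admissible T f) (hf : f ∈ locallyRegular T) : D.cauchyIntegral T f = funCalc T f :=
  let ⟨_, ha⟩ := exists_isRegularSeriesNear hf
  (hD.hasSum_cauchyIntegral ha).unique ha.hasSum_funCalc

theorem funCalc_add (hf : f ∈ locallyRegular T) (hg : g ∈ locallyRegular T) :
    f + g ∈ locallyRegular T ∧ funCalc T (f + g) = funCalc T f + funCalc T g := by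
  obtain ⟨a, ha⟩ := exists_isRegularSeriesNear hf
  obtain ⟨b, hb⟩ := exists_isRegularSeriesNear hg
  refine ⟨(ha.add hb).mem_locallyRegular, (ha.add hb).hasSum_funCalc.unique ?_⟩
  refine (ha.hasSum_funCalc.add hb.hasSum_funCalc).congr_fun fun m => ?_
  rw [← mul_add]
  exact congrArg _ (map_add (leftMulHom V) _ _)

theorem funCalc_mul_const (hf : f ∈ locallyRegular T) (c : ℍ[ℝ]) :
    (fun s => f s * c) ∈ locallyRegular T ∧
      funCalc T (fun s => f s * c) = funCalc T f * leftMul c := by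
  obtain ⟨a, ha⟩ := exists_isRegularSeriesNear hf
  refine ⟨(ha.mul_const c).mem_locallyRegular, (ha.mul_const c).hasSum_funCalc.unique ?_⟩
  refine (ha.hasSum_funCalc.mul_right (leftMul c)).congr_fun fun m => ?_
  rw [mul_assoc]
  exact congrArg _ (leftMul_mul _ _)

theorem funCalc_mul (hf : f ∈ locallyRegular T) (hg : g ∈ locallyRegular T)
    (hs : IsRealPowerSeriesNear T f) :
    f * g ∈ locallyRegular T ∧ funCalc T (f * g) = funCalc T f * funCalc T g := by
  obtain ⟨r, hr⟩ := hs.exists_isRegularSeriesNear hf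
  obtain ⟨b, hb⟩ := exists_isRegularSeriesNear hg
  refine ⟨(hr.real_mul hb).mem_locallyRegular, (hr.real_mul hb).hasSum_funCalc.unique ?_⟩
  have hreal : ∀ x : ℝ, (leftMul (x : ℍ[ℝ]) : BoundedOp V) = algebraMap ℝ _ x :=
    (leftMulHom V).commutes
  have hrsum := hr.summable_norm
  have hrT := hr.hasSum_funCalc
  simp only [hreal] at hrsum hrT
  refine (hasSum_pow_mul_sum_antidiagonal hrsum hb.summable_norm hrT
    hb.hasSum_funCalc).congr_fun fun m => ?_
  simp only [← leftMulHom_apply, map_sum, map_smul]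

end Operators

end QuaternionicCalculus

end

theorem theorem5_general {V : Type*} [NormedAddCommGroup V] [NormedSpace ℝ V] [CompleteSpace V]
    [Module ℍ[ℝ] V] [IsBoundedSMul ℍ[ℝ] V] [IsScalarTower ℝ ℍ[ℝ] V]
    [Module ℍ[ℝ]ᵐᵒᵖ V] [IsBoundedSMul ℍ[ℝ]ᵐᵒᵖ V] [IsScalarTower ℝ ℍ[ℝ]ᵐᵒᵖ V]
    [SMulCommClass ℍ[ℝ] ℍ[ℝ]ᵐᵒᵖ V] (T : BoundedOp V) :
    (∀ f ∈ locallyRegular T, (∃ D : SliceDomain, D.Admissible T f) ∧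
      ∀ D : SliceDomain, D.Admissible T f → D.cauchyIntegral T f = funCalc T f) ∧
    (∀ f ∈ locallyRegular T, ∀ g ∈ locallyRegular T,
      f + g ∈ locallyRegular T ∧ funCalc T (f + g) = funCalc T f + funCalc T g) ∧
    (∀ f ∈ locallyRegular T, ∀ c : ℍ[ℝ],
      (fun s => f s * c) ∈ locallyRegular T ∧
        funCalc T (fun s => f s * c) = funCalc T f * leftMul c) ∧
    (∀ φ ∈ locallyRegular T, ∀ ψ ∈ locallyRegular T,
      IsRealPowerSeriesNear T φ →
        φ * ψ ∈ locallyRegular T ∧ funCalc T (φ * ψ) = funCalc T φ * funCalc T ψ) :=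
  ⟨fun _ hf => ⟨exists_admissible hf, fun _ hD => hD.cauchyIntegral_eq_funCalc hf⟩,
    fun _ hf _ hg => funCalc_add hf hg, fun _ hf c => funCalc_mul_const hf c,
    fun _ hφ _ hψ hs => funCalc_mul hφ hψ hs⟩

theorem theorem5 {V : Type*} [NormedAddCommGroup V] [NormedSpace ℝ V] [CompleteSpace V]
    [Module ℍ[ℝ] V] [IsBoundedSMul ℍ[ℝ] V] [IsScalarTower ℝ ℍ[ℝ] V]
    [Module ℍ[ℝ]ᵐᵒᵖ V] [IsBoundedSMul ℍ[ℝ]ᵐᵒᵖ V] [IsScalarTower ℝ ℍ[ℝ]ᵐᵒᵖ V]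
    [SMulCommClass ℍ[ℝ] ℍ[ℝ]ᵐᵒᵖ V] (T : BoundedOp V) :
    (∀ f ∈ locallyRegular T, (∃ D : SliceDomain, D.Admissible T f) ∧
      ∀ D : SliceDomain, D.Admissible T f → D.cauchyIntegral T f = funCalc T f) ∧
    (∀ f ∈ locallyRegular T, ∀ g ∈ locallyRegular T,
      f + g ∈ locallyRegular T ∧ funCalc T (f + g) = funCalc T f + funCalc T g) ∧
    (∀ f ∈ locallyRegular T, ∀ c : ℍ[ℝ],
      (fun s => f s * c) ∈ locallyRegular T ∧
        funCalc T (fun s => f s * c) = funCalc T f * leftMul c) ∧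
    (∀ φ ∈ locallyRegular T, ∀ ψ ∈ locallyRegular T,
      IsRealPowerSeriesNear T φ → IsRealPowerSeriesNear T ψ →
        φ * ψ ∈ locallyRegular T ∧ funCalc T (φ * ψ) = funCalc T φ * funCalc T ψ) :=
  let ⟨h₁, h₂, h₃, h₄⟩ := theorem5_general T
  ⟨h₁, h₂, h₃, fun φ hφ ψ hψ hs _ => h₄ φ hφ ψ hψ hs⟩
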